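/- **Setting.** Let $\mathcal A$ be a (possibly non-unital) $C^*$-algebra, $\mathcal B$ a unital $C^*$-algebra, $\mathbf V$ a right $\mathcal A$-module, $G$ a group, $U$ a representation of $G$ on $\mathbf V$ by $\mathcal A$-linear bijections, and $\beta$ an action of $G$ on $\mathcal B$ by $*$-automorphisms. Let $S_{\mathcal A}(\mathbf V)$ be the vector space of $\mathcal A$-sesquilinear forms $s:\mathbf V\times\mathbf V\to\mathcal A$, that is, $s$ is conjugate linear in the first and linear in the second variable, $s(u,va)=s(u,v)a$ and $s(ua,v)=a^*s(u,v)$. Fix a positive form $s_1\in S_{\mathcal A}(\mathbf V)$ (i.e. $s_1(v,v)\ge 0$ for all $v$). Let $\mathbf{CP}^U_\beta(s_1)$ be the convex set of linear maps $S:\mathcal B\to S_{\mathcal A}(\mathbf V)$, $b\mapsto S_b$, such that * $\sum_{j,k=1}^n S_{b_j^*b_k}(v_j,v_k)\ge 0$ for all $n$, $b_j\in\mathcal B$, $v_j\in\mathbf V$ (complete positivity), * $S_{\beta_g(b)}(v,w)=S_b\big(U(g^{-1})v,U(g^{-1})w\big)$ for all $g,b,v,w$ (covariance), * $S_{1_{\mathcal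 B}}=s_1$. For a Hilbert $\mathcal A$-module $\mathbf M$ let $\mathcal L_{\mathcal A}(\mathbf M)$ be the algebra of adjointable bounded $\mathcal A$-linear operators on $\mathbf M$; $\mathbf M$ is *self-dual* if every bounded $\mathcal A$-linear map $\mathbf M\to\mathcal A$ is of the form $\langle m|\cdot\rangle$ for some $m\in\mathbf M$. A *covariant dilation* of $S$ is a quadruple $(\mathbf M,\pi,J,\tilde U)$ of a Hilbert $\mathcal A$-module $\mathbf M$, a unital $*$-homomorphism $\pi:\mathcal B\to\mathcal L_{\mathcal A}(\mathbf M)$, an $\mathcal A$-linear map $J:\mathbf V\to\mathbf M$ and a representation $\tilde U$ of $G$ by unitaries of $\mathcal L_{\mathcal A}(\mathbf M)$ such that $S_b(v,w)=\langle Jv|\pi(b)Jw\rangle$, $JU(g)=\tilde U(g)J$ and $\tilde U(g)\pi(b)=\pi(\beta_g(b))\tilde U(g)$ for all $b,v,w,g$. It is *minimal* if $\mathrm{lin}_{\mathbb C}\{\pi(b)Jv\mid b\in\mathcal B,\ v\in\mathbf V\}$ is norm dense in $\mathbf M$. When $\mathcal A$ is a $W^*$-algebra, it is *$W^*$-minimal*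 if $\mathbf M$ is self-dual and this linear span is dense in $\mathbf M$ for the topology given by the seminorms $m\mapsto\sqrt{\varphi(\langle m|m\rangle)}$ or for the topology given by the seminorms $m\mapsto|\varphi(\langle m'|m\rangle)|$, where $\varphi$ runs through the normal positive functionals on $\mathcal A$ and $m'$ through $\mathbf M$. When $\mathcal A$ and $\mathcal B$ are $W^*$-algebras, let $\mathbf{NCP}^U_\beta(s_1)$ be the set of those $S\in\mathbf{CP}^U_\beta(s_1)$ for which $b\mapsto S_b(v,v)$ is normal for every $v\in\mathbf V$, i.e. preserves the suprema of bounded increasing nets of self-adjoint elements. For a covariant dilation $(\mathbf M,\pi,J,\tilde U)$ consider the condition $(\ast)$ if $D\in\mathcal L_{\mathcal A}(\mathbf M)$ satisfies $[D,\pi(b)]=0$ for all $b\in\mathcal B$, $[D,\tilde U(g)]=0$ for all $g\in G$, and $\langle Jv|DJv\rangle=0$ for all $v\in\mathbf V$, then $D=0$. **Theorem.** Let $S\in\mathbf{CP}^U_\beta(s_1)$. 1. Let $(\mathbf M,\pi,J,\tilde U)$ be a minimal covariant dilation of $S$. If $S$ is an extreme point of $\mathbf{CP}^U_\beta(s_1)$,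 then $(\ast)$ holds. If $\mathbf M$ is self-dual, then conversely $(\ast)$ implies that $S$ is an extreme point of $\mathbf{CP}^U_\beta(s_1)$. 2. Suppose that $\mathcal A$ is a $W^*$-algebra and let $(\mathbf L,\pi,J,\tilde U)$ be a $W^*$-minimal covariant dilation of $S$. Then $S$ is an extreme point of $\mathbf{CP}^U_\beta(s_1)$ if and only if $(\ast)$ holds for $(\mathbf L,\pi,J,\tilde U)$. 3. Suppose that $\mathcal A$ and $\mathcal B$ are $W^*$-algebras and $S\in\mathbf{NCP}^U_\beta(s_1)$. Then $S$ is an extreme point of $\mathbf{NCP}^U_\beta(s_1)$ if and only if it is an extreme point of $\mathbf{CP}^U_\beta(s_1)$. -/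

import Mathlib

open scoped ComplexOrder

noncomputable section

namespace CovCP

universe u

open MulOpposite

/-! ### Right modules over a (possibly non-unital) C⋆-algebra -/

/-- The right action `v a` of `a : A` on `v` is the scalar action `op a • v` of the opposite
algebra. This is the usual notion of a complex right `A`-module, for `A` possibly non-unital. -/
class IsRightModule (A V : Type*) [NonUnitalCStarAlgebra A] [AddCommGroup V] [Module ℂ V]
    [SMul Aᵐᵒᵖ V] : Prop where
  act_add (v w : V) (a : A) : op a • (v + w) = op a • v + op a • w
  add_act (v : V) (a b : A) : op (a + b) • v = op a • v + op b • v
  act_mul (v : V) (a b : A) : op (a * b) • v = op b • (op a • v)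
  act_complex_smul (c : ℂ) (v : V) (a : A) : op a • (c • v) = c • (op a • v)
  complex_smul_act (c : ℂ) (v : V) (a : A) : op (c • a) • v = c • (op a • v)

/-- Compatibility with the right actions of `A`: `T (v a) = (T v) a`. -/
def IsModuleMap (A : Type*) {V W : Type*} [SMul Aᵐᵒᵖ V] [SMul Aᵐᵒᵖ W] (T : V → W) : Prop :=
  ∀ (v : V) (a : A), T (op a • v) = op a • T v

/-! ### `A`-sesquilinear forms -/

section Sesq

variable (A V : Type*) [NonUnitalCStarAlgebra A] [AddCommGroup V] [Module ℂ V] [SMul Aᵐᵒᵖ V]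

/-- The complex vector space of `A`-sesquilinear forms on `V`, conjugate linear in the first and
linear in the second variable. -/
def SesqForm : Submodule ℂ (V →ₗ⋆[ℂ] V →ₗ[ℂ] A) where
  carrier := {s | (∀ u v (a : A), s u (op a • v) = s u v * a) ∧
    ∀ u v (a : A), s (op a • u) v = star a * s u v}
  add_mem' := by
    rintro s t ⟨hs, hs'⟩ ⟨ht, ht'⟩
    exact ⟨fun u v a => by simp [hs, ht, add_mul], fun u v a => by simp [hs', ht', mul_add]⟩
  zero_mem' := by simp
  smul_mem' := by
    rintro c s ⟨hs, hs'⟩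
    exact ⟨fun u v a => by simp [hs, smul_mul_assoc], fun u v a => by simp [hs', mul_smul_comm]⟩

variable {A V}

/-- `s v v ≥ 0` for all `v`. -/
def SesqForm.IsPositive [PartialOrder A] (s : SesqForm A V) : Prop :=
  ∀ v, 0 ≤ s.1 v v

end Sesq

/-! ### Normal maps and W⋆-algebras -/

/-- `f` preserves the suprema of bounded increasing nets of self-adjoint elements. -/
def IsNormalMap {B C : Type*} [Star B] [Preorder B] [Preorder C] (f : B → C) : Prop :=
  ∀ D : Set B, D.Nonempty → DirectedOn (· ≤ ·) D → (∀ b ∈ D, IsSelfAdjoint b) →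
    ∀ s, IsLUB D s → IsLUB (f '' D) (f s)

/-- A W⋆-algebra is a C⋆-algebra which is ⋆-isomorphic to a von Neumann algebra on some Hilbert
space (in particular it is unital). -/
def IsWStarAlgebra (A : Type u) [NonUnitalCStarAlgebra A] : Prop :=
  ∃ (H : Type u) (_ : NormedAddCommGroup H) (_ : InnerProductSpace ℂ H) (_ : CompleteSpace H)
    (N : VonNeumannAlgebra H), Nonempty (A ≃⋆ₐ[ℂ] N.toStarSubalgebra)

/-! ### Hilbert modules

Mathlib's `CStarModule A M` is written for left actions, `⟪x, a • y⟫ = a * ⟪x, y⟫`. A right Hilbert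
module over `A` is therefore a complete space `M` with `CStarModule Aᵐᵒᵖ M`; the axioms of a right
module hold automatically because the inner product is non-degenerate. -/

section Hilbert

variable (A : Type*) [NonUnitalCStarAlgebra A] [PartialOrder A] [StarOrderedRing A]
  {M : Type*} [NormedAddCommGroup M] [NormedSpace ℂ M] [SMul Aᵐᵒᵖ M] [CStarModule Aᵐᵒᵖ M]

/-- The `A`-valued inner product `⟨x|y⟩` of a right Hilbert `A`-module. -/
def ip (x y : M) : A := unop (inner Aᵐᵒᵖ x y)

/-- `T'` is an adjoint of `T`. -/
def IsAdjointPair (T T' : M →L[ℂ] M) : Prop :=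
  ∀ x y : M, ip A x (T y) = ip A (T' x) y

/-- `T` belongs to the algebra of bounded adjointable `A`-linear operators on `M`. -/
def IsAdjointable (T : M →L[ℂ] M) : Prop :=
  IsModuleMap A T ∧ ∃ T' : M →L[ℂ] M, IsModuleMap A T' ∧ IsAdjointPair A T T'

/-- `T` is a unitary element of the algebra of adjointable operators on `M`. -/
def IsUnitaryOp (T : M →L[ℂ] M) : Prop :=
  IsModuleMap A T ∧ ∃ T' : M →L[ℂ] M, IsModuleMap A T' ∧ IsAdjointPair A T T' ∧
    T * T' = 1 ∧ T' * T = 1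

variable (M)

/-- Every bounded `A`-linear map `M → A` is of the form `⟨m|·⟩`. -/
def IsSelfDual : Prop :=
  ∀ f : M →L[ℂ] A, (∀ (x : M) (a : A), f (op a • x) = f x * a) → ∃ m : M, ∀ x, f x = ip A m x

/-- The topology given by the seminorms `x ↦ √φ(⟨x|x⟩)`, with `φ` running through the normal
positive linear functionals on `A`. -/
@[reducible]
def tau₁ : TopologicalSpace M :=
  TopologicalSpace.generateFrom
    {O | ∃ (φ : A →ₚ[ℂ] ℂ) (x₀ : M) (ε : ℝ), IsNormalMap φ ∧
      O = {x | √(φ (ip A (x - x₀) (x - x₀))).re < ε}}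

/-- The topology given by the seminorms `x ↦ |φ(⟨y|x⟩)|`, with `φ` running through the normal
positive linear functionals on `A` and `y` through `M`. -/
@[reducible]
def tau₂ : TopologicalSpace M :=
  TopologicalSpace.generateFrom
    {O | ∃ (φ : A →ₚ[ℂ] ℂ) (y x₀ : M) (ε : ℝ), IsNormalMap φ ∧
      O = {x | ‖φ (ip A y (x - x₀))‖ < ε}}

end Hilbert

/-! ### Covariant completely positive maps and their dilations -/

section CP

variable {A B V G : Type*} [NonUnitalCStarAlgebra A] [PartialOrder A] [StarOrderedRing A]
  [CStarAlgebra B] [AddCommGroup V] [Module ℂ V] [SMul Aᵐᵒᵖ V] [Group G]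

/-- Complete positivity of a linear map from `B` to the `A`-sesquilinear forms on `V`. -/
def IsCP (S : B →ₗ[ℂ] SesqForm A V) : Prop :=
  ∀ (n : ℕ) (b : Fin n → B) (v : Fin n → V),
    0 ≤ ∑ j, ∑ k, (S (star (b j) * b k)).1 (v j) (v k)

/-- `(β, U)`-covariance. -/
def IsCovariant (β : G →* (B ≃⋆ₐ[ℂ] B)) (U : G →* (V ≃ₗ[ℂ] V)) (S : B →ₗ[ℂ] SesqForm A V) : Prop :=
  ∀ g b v w, (S (β g b)).1 v w = (S b).1 (U g⁻¹ v) (U g⁻¹ w)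

/-- The covariant CP maps `S` with `S 1 = s₁`. -/
def CP (β : G →* (B ≃⋆ₐ[ℂ] B)) (U : G →* (V ≃ₗ[ℂ] V)) (s₁ : SesqForm A V) :
    Set (B →ₗ[ℂ] SesqForm A V) :=
  {S | IsCP S ∧ IsCovariant β U S ∧ S 1 = s₁}

/-- The normal covariant CP maps `S` with `S 1 = s₁`. -/
def NCP [PartialOrder B] (β : G →* (B ≃⋆ₐ[ℂ] B)) (U : G →* (V ≃ₗ[ℂ] V)) (s₁ : SesqForm A V) :
    Set (B →ₗ[ℂ] SesqForm A V) :=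
  {S | S ∈ CP β U s₁ ∧ ∀ v : V, IsNormalMap fun b : B => (S b).1 v v}

/-- A covariant dilation of `S` on the Hilbert module `M`, without any minimality requirement. -/
structure CovariantDilation (β : G →* (B ≃⋆ₐ[ℂ] B)) (U : G →* (V ≃ₗ[ℂ] V))
    (S : B →ₗ[ℂ] SesqForm A V) (M : Type*) [NormedAddCommGroup M] [NormedSpace ℂ M]
    [SMul Aᵐᵒᵖ M] [CStarModule Aᵐᵒᵖ M] where
  /-- the unital ⋆-homomorphism into the adjointable operators -/
  π : B →ₐ[ℂ] (M →L[ℂ] M)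
  π_module : ∀ b, IsModuleMap A (π b)
  π_star : ∀ b, IsAdjointPair A (π b) (π (star b))
  /-- the `A`-linear map from `V` to `M` -/
  J : V →ₗ[ℂ] M
  J_module : IsModuleMap A J
  /-- the unitary representation of `G` -/
  Ut : G →* (M →L[ℂ] M)
  Ut_unitary : ∀ g, IsUnitaryOp A (Ut g)
  dilates : ∀ b v w, (S b).1 v w = ip A (J v) (π b (J w))
  J_covariant : ∀ g v, J (U g v) = Ut g (J v)
  π_covariant : ∀ g b, Ut g * π b = π (β g b) * Ut g

namespace CovariantDilation

variable {β : G →* (B ≃⋆ₐ[ℂ] B)} {U : G →* (V ≃ₗ[ℂ] V)} {S : B →ₗ[ℂ] SesqForm A V}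
  {M : Type*} [NormedAddCommGroup M] [NormedSpace ℂ M] [SMul Aᵐᵒᵖ M] [CStarModule Aᵐᵒᵖ M]

/-- The linear span of the vectors `π(b)Jv`. -/
def range (d : CovariantDilation β U S M) : Submodule ℂ M :=
  Submodule.span ℂ {x | ∃ b v, x = d.π b (d.J v)}

/-- Minimality: the vectors `π(b)Jv` span a norm dense subspace. -/
def IsMinimal (d : CovariantDilation β U S M) : Prop :=
  Dense (d.range : Set M)

/-- W⋆-minimality: `M` is self-dual and the vectors `π(b)Jv` span a subspace which is dense for
the first, respectively the second, of the topologies above (either is allowed). -/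
def IsWStarMinimal (d : CovariantDilation β U S M) : Prop :=
  IsSelfDual A M ∧
    (@Dense M (tau₁ A M) (d.range : Set M) ∨ @Dense M (tau₂ A M) (d.range : Set M))

/-- The only adjointable `D` commuting with `π(B)` and `Ũ(G)` and with `⟨Jv|DJv⟩ = 0` for all `v`
is `D = 0`. -/
def ExtremalityCondition (d : CovariantDilation β U S M) : Prop :=
  ∀ D : M →L[ℂ] M, IsAdjointable A D → (∀ b, Commute D (d.π b)) → (∀ g, Commute D (d.Ut g)) →
    (∀ v, ip A (d.J v) (D (d.J v)) = 0) → D = 0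

end CovariantDilation

end CP

end CovCP

end

/-!
The commutant of `π(B)` and `Ũ(G)` in `𝓛_A(M)` parametrizes the perturbations of `S`. If `D` is a
small self-adjoint element of it with `⟨Jv|DJv⟩ = 0`, then the maps `b ↦ ⟨J · |π(b)(1 ± D)J · ⟩` lie
in `CP` and have midpoint `S`, so that extremality of `S` forces `D = 0`.

Conversely, if `S` is a proper convex combination of `R` and `R'`, then `R ≤ c S` for some `c`.
Hence the sesquilinear form of `R` on `B ⊗ V` is bounded by the inner product of `M`, and on a
self-dual module it is given by an operator `D` in the commutant: `R b = ⟨J · |π(b)DJ · ⟩`. As `R`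
and `S` agree at `1`, condition (∗) for `D - 1` gives `R = S`. This uses Riesz representation for
the bounded `A`-linear functionals on the span of the `π(b)Jv`.

If the span is norm dense, such functionals extend to `M`. If it is only dense in one of the weak
topologies, then a functional of norm at most `C` is approximated on every finite set by vectors of
norm at most `C`, and these have a weak limit point, since the balls of a von Neumann algebra are
compact in the weak operator topology.

For the last part: if a sum of monotone maps is normal, then so are the summands. Hence `NCP` is a
face of `CP`.
-/

noncomputable section

namespace CovCP

universe u

open MulOpposite Filter

open scoped Topology

section InnerProduct

variable (A : Type*) [NonUnitalCStarAlgebra A] [PartialOrder A]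
  {M : Type*} [NormedAddCommGroup M] [NormedSpace ℂ M] [SMul Aᵐᵒᵖ M] [CStarModule Aᵐᵒᵖ M]

@[simp] lemma star_ip (x y : M) : star (ip A x y) = ip A y x :=
  congrArg unop (CStarModule.star_inner (A := Aᵐᵒᵖ) x y)

@[simp] lemma ip_add_right (x y z : M) : ip A x (y + z) = ip A x y + ip A x z := by simp [ip]

@[simp] lemma ip_add_left (x y z : M) : ip A (x + y) z = ip A x z + ip A y z := by simp [ip]

@[simp] lemma ip_smul_right (c : ℂ) (x y : M) : ip A x (c • y) = c • ip A x y := by simp [ip]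

@[simp] lemma ip_smul_left (c : ℂ) (x y : M) : ip A (c • x) y = star c • ip A x y := by
  simp [ip]

@[simp] lemma ip_zero_right (x : M) : ip A x 0 = 0 := by simp [ip]

@[simp] lemma ip_zero_left (x : M) : ip A 0 x = 0 := by simp [ip]

@[simp] lemma ip_sub_right (x y z : M) : ip A x (y - z) = ip A x y - ip A x z := by simp [ip]

@[simp] lemma ip_sub_left (x y z : M) : ip A (x - y) z = ip A x z - ip A y z := by simp [ip]

@[simp] lemma ip_act_right (x y : M) (a : A) : ip A x (op a • y) = ip A x y * a := by simp [ip]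

@[simp] lemma ip_act_left (x y : M) (a : A) : ip A (op a • x) y = star a * ip A x y := by
  simp [ip]

lemma ip_sum_right {ι : Type*} (s : Finset ι) (x : M) (y : ι → M) :
    ip A x (∑ i ∈ s, y i) = ∑ i ∈ s, ip A x (y i) := by simp [ip]

lemma ip_sum_left {ι : Type*} (s : Finset ι) (x : ι → M) (y : M) :
    ip A (∑ i ∈ s, x i) y = ∑ i ∈ s, ip A (x i) y := by simp [ip]

lemma ip_self_nonneg (x : M) : 0 ≤ ip A x x :=
  (CStarModule.inner_self_nonneg : 0 ≤ inner Aᵐᵒᵖ x x)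

lemma norm_sq_eq_norm_ip (x : M) : ‖x‖ ^ 2 = ‖ip A x x‖ := CStarModule.norm_sq_eq Aᵐᵒᵖ

variable {A}

lemma eq_zero_of_ip_self {x : M} (h : ip A x x = 0) : x = 0 :=
  (CStarModule.inner_self (A := Aᵐᵒᵖ)).1 (unop_injective h)

lemma ext_ip_left {x y : M} (h : ∀ z, ip A z x = ip A z y) : x = y :=
  sub_eq_zero.1 (eq_zero_of_ip_self (A := A) (by rw [ip_sub_right, h, sub_self]))

lemma ext_ip_right {x y : M} (h : ∀ z, ip A x z = ip A y z) : x = y :=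
  sub_eq_zero.1 (eq_zero_of_ip_self (A := A) (by rw [ip_sub_left, h, sub_self]))

lemma norm_le_of_norm_ip_le {x : M} {C : ℝ} (hC : 0 ≤ C) (h : ∀ y, ‖ip A x y‖ ≤ C * ‖y‖) :
    ‖x‖ ≤ C := by
  rcases (norm_nonneg x).eq_or_lt with h₀ | h₀
  · rwa [← h₀]
  · exact le_of_mul_le_mul_right (by simpa only [← norm_sq_eq_norm_ip, sq] using h x) h₀

variable (A) [StarOrderedRing A]

lemma norm_ip_le (x y : M) : ‖ip A x y‖ ≤ ‖x‖ * ‖y‖ := CStarModule.norm_inner_le (A := Aᵐᵒᵖ) M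

lemma continuous_ip : Continuous fun p : M × M => ip A p.1 p.2 :=
  continuous_unop.comp (CStarModule.continuous_inner (A := Aᵐᵒᵖ))

/-- The bounded linear map `y ↦ ⟨x|y⟩`. -/
def ipL (x : M) : M →L[ℂ] A :=
  LinearMap.mkContinuous
    { toFun := ip A x
      map_add' := ip_add_right A x
      map_smul' := fun c y => ip_smul_right A c x y } ‖x‖ (norm_ip_le A x)

lemma norm_act_le (x : M) (a : A) : ‖op a • x‖ ≤ ‖a‖ * ‖x‖ := by
  refine norm_le_of_norm_ip_le (A := A) (by positivity) fun y => ?_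
  calc ‖ip A (op a • x) y‖ ≤ ‖star a‖ * ‖ip A x y‖ := by
        rw [ip_act_left]
        exact norm_mul_le _ _
    _ ≤ ‖a‖ * (‖x‖ * ‖y‖) := by
        rw [norm_star]
        gcongr
        exact norm_ip_le A x y
    _ = ‖a‖ * ‖x‖ * ‖y‖ := by ring

/-- The right action of `a` on a Hilbert module, as a bounded linear map. The module axioms it
needs follow from the non-degeneracy of the inner product. -/
def actL (a : A) : M →L[ℂ] M :=
  LinearMap.mkContinuous
    { toFun := fun x => op a • x
      map_add' := fun x y => ext_ip_left (A := A) fun z => by simp [add_mul]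
      map_smul' := fun c x => ext_ip_left (A := A) fun z => by simp [smul_mul_assoc] }
    ‖a‖ fun x => norm_act_le A x a

@[simp] lemma actL_apply (a : A) (x : M) : actL A a x = op a • x := rfl

end InnerProduct

section Adjointable

variable {A : Type*} [NonUnitalCStarAlgebra A] [PartialOrder A]
  {M : Type*} [NormedAddCommGroup M] [NormedSpace ℂ M] [SMul Aᵐᵒᵖ M] [CStarModule Aᵐᵒᵖ M]
  {T T' R R' : M →L[ℂ] M}

lemma IsAdjointPair.symm (h : IsAdjointPair A T T') : IsAdjointPair A T' T := fun x y => by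
  rw [← star_ip, ← h y x, star_ip]

lemma IsAdjointPair.isModuleMap (h : IsAdjointPair A T T') : IsModuleMap A T := fun x a =>
  ext_ip_left (A := A) fun z => by rw [h, ip_act_right, ip_act_right, h]

lemma IsAdjointPair.isAdjointable (h : IsAdjointPair A T T') : IsAdjointable A T :=
  ⟨h.isModuleMap, T', h.symm.isModuleMap, h⟩

lemma IsAdjointPair.unique (h : IsAdjointPair A T T') (k : IsAdjointPair A T R') : T' = R' :=
  ContinuousLinearMap.ext fun x => ext_ip_right (A := A) fun y => by rw [← h, ← k]

lemma IsAdjointPair.add (h : IsAdjointPair A T T') (k : IsAdjointPair A R R') :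
    IsAdjointPair A (T + R) (T' + R') := fun x y => by
  simp only [add_apply, ip_add_left, ip_add_right, h x y, k x y]

lemma IsAdjointPair.smul (h : IsAdjointPair A T T') (c : ℂ) :
    IsAdjointPair A (c • T) (star c • T') := fun x y => by
  simp only [smul_apply, ip_smul_left, ip_smul_right, h x y, star_star]

lemma IsAdjointPair.mul (h : IsAdjointPair A T T') (k : IsAdjointPair A R R') :
    IsAdjointPair A (T * R) (R' * T') := fun x y => by
  simp only [mul_apply_eq_comp, h x, k (T' x)]

lemma IsAdjointPair.algebraMap (c : ℂ) : IsAdjointPair A (algebraMap ℂ (M →L[ℂ] M) c)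
    (algebraMap ℂ (M →L[ℂ] M) (star c)) := fun x y => by
  simp [Algebra.algebraMap_eq_smul_one]

lemma IsUnitaryOp.isAdjointable (h : IsUnitaryOp A T) : IsAdjointable A T :=
  ⟨h.1, h.2.imp fun _ k => ⟨k.1, k.2.1⟩⟩

variable (A M)

/-- The algebra `𝓛_A(M)` of adjointable operators on the Hilbert module `M`. -/
def adjointable : Subalgebra ℂ (M →L[ℂ] M) where
  carrier := {T | IsAdjointable A T}
  mul_mem' := by
    rintro T R ⟨-, T', -, h⟩ ⟨-, R', -, k⟩
    exact (h.mul k).isAdjointable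
  add_mem' := by
    rintro T R ⟨-, T', -, h⟩ ⟨-, R', -, k⟩
    exact (h.add k).isAdjointable
  algebraMap_mem' c := (IsAdjointPair.algebraMap c).isAdjointable

variable {A M}

namespace adjointable

lemma exists_isAdjointPair (T : adjointable A M) :
    ∃ T' : adjointable A M, IsAdjointPair A T.1 T'.1 :=
  let ⟨_, T', _, h⟩ := T.2
  ⟨⟨T', h.symm.isAdjointable⟩, h⟩

instance : NormedRing (adjointable A M) := inferInstance

instance : Star (adjointable A M) := ⟨fun T => (exists_isAdjointPair T).choose⟩

lemma isAdjointPair_star (T : adjointable A M) : IsAdjointPair A T.1 (star T).1 :=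
  (exists_isAdjointPair T).choose_spec

lemma star_eq_of_isAdjointPair {T T' : adjointable A M} (h : IsAdjointPair A T.1 T'.1) :
    star T = T' :=
  Subtype.ext ((isAdjointPair_star T).unique h)

instance : StarRing (adjointable A M) where
  star_involutive T := star_eq_of_isAdjointPair (isAdjointPair_star T).symm
  star_mul T R :=
    star_eq_of_isAdjointPair ((isAdjointPair_star T).mul (isAdjointPair_star R))
  star_add T R :=
    star_eq_of_isAdjointPair ((isAdjointPair_star T).add (isAdjointPair_star R))

instance : StarModule ℂ (adjointable A M) where
  star_smul c T := star_eq_of_isAdjointPair ((isAdjointPair_star T).smul c)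

lemma isSelfAdjoint_iff {T : adjointable A M} : IsSelfAdjoint T ↔ IsAdjointPair A T.1 T.1 :=
  ⟨fun h => by simpa only [h.star_eq] using isAdjointPair_star T, star_eq_of_isAdjointPair⟩

lemma ip_star_mul_self (T : adjointable A M) (x : M) :
    ip A x ((star T * T).1 x) = ip A (T.1 x) (T.1 x) :=
  (isAdjointPair_star T).symm x (T.1 x)

variable [StarOrderedRing A]

instance : CStarRing (adjointable A M) where
  norm_mul_self_le T := by
    have hbound : ‖T‖ ≤ √‖star T * T‖ :=
      T.1.opNorm_le_bound (Real.sqrt_nonneg _) fun x => by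
        refine le_of_sq_le_sq ?_ (by positivity)
        rw [mul_pow, Real.sq_sqrt (norm_nonneg (star T * T))]
        calc ‖T.1 x‖ ^ 2 = ‖ip A x ((star T * T).1 x)‖ := by
              rw [norm_sq_eq_norm_ip A, ip_star_mul_self]
          _ ≤ ‖x‖ * (‖star T * T‖ * ‖x‖) :=
              (norm_ip_le A _ _).trans (by gcongr; exact (star T * T).1.le_opNorm x)
          _ = ‖star T * T‖ * ‖x‖ ^ 2 := by ring
    calc ‖T‖ * ‖T‖ ≤ √‖star T * T‖ * √‖star T * T‖ := by gcongr
      _ = ‖star T * T‖ := Real.mul_self_sqrt (norm_nonneg _)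

instance [CompleteSpace M] : CompleteSpace (adjointable A M) := by
  refine Metric.complete_of_cauchySeq_tendsto fun u hu => ?_
  have hval : UniformContinuous ((↑) : adjointable A M → M →L[ℂ] M) :=
    uniformContinuous_subtype_val
  have hstar : UniformContinuous (star : adjointable A M → adjointable A M) :=
    star_isometry.uniformContinuous
  obtain ⟨T, hT⟩ := cauchySeq_tendsto_of_complete (hval.comp_cauchySeq hu)
  obtain ⟨T', hT'⟩ := cauchySeq_tendsto_of_complete ((hval.comp hstar).comp_cauchySeq hu)
  have hpair : IsAdjointPair A T T' := fun x y => by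
    have hleft : Tendsto (fun n => ip A x ((u n).1 y)) atTop (𝓝 (ip A x (T y))) :=
      ((ipL A x ∘L ContinuousLinearMap.apply ℂ M y).continuous.tendsto T).comp hT
    have hright : Tendsto (fun n => ip A ((star (u n)).1 x) y) atTop
        (𝓝 (ip A (T' x) y)) :=
      ((continuous_ip A).tendsto (T' x, y)).comp
        ((((ContinuousLinearMap.apply ℂ M x).continuous.tendsto T').comp hT').prodMk_nhds
          tendsto_const_nhds)
    exact tendsto_nhds_unique hleft (hright.congr fun n => (isAdjointPair_star (u n) x y).symm)
  exact ⟨⟨T, hpair.isAdjointable⟩, tendsto_subtype_rng.2 hT⟩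

instance [CompleteSpace M] : CStarAlgebra (adjointable A M) where

lemma ip_apply_le_of_norm_le_one [CompleteSpace M] {D : adjointable A M} (hD : IsSelfAdjoint D)
    (hnorm : ‖D‖ ≤ 1) (x : M) : ip A x (D.1 x) ≤ ip A x x := by
  let : PartialOrder (adjointable A M) := CStarAlgebra.spectralOrder _
  let : StarOrderedRing (adjointable A M) := CStarAlgebra.spectralOrderedRing _
  have hle : D ≤ 1 := hD.le_algebraMap_norm_self.trans <| by
    simpa only [map_one] using algebraMap_mono (adjointable A M) hnorm
  obtain ⟨c, hc⟩ := CStarAlgebra.nonneg_iff_eq_star_mul_self.1 (sub_nonneg.2 hle)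
  have hnonneg : 0 ≤ ip A x ((1 - D).1 x) := by
    rw [hc, ip_star_mul_self]
    exact ip_self_nonneg A _
  simpa using hnonneg

end adjointable

end Adjointable

section Sesquilinear

variable {E F : Type*} [AddCommGroup E] [Module ℂ E] [AddCommGroup F] [Module ℂ F]

lemma sesq_smul_left (s : E →ₗ⋆[ℂ] E →ₗ[ℂ] F) (c : ℂ) (x y : E) :
    s (c • x) y = star c • s x y := by
  rw [LinearMap.map_smulₛₗ, LinearMap.smul_apply, starRingEnd_apply]

lemma sesq_polarization (s : E →ₗ⋆[ℂ] E →ₗ[ℂ] F) (x y : E) :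
    (4 : ℂ) • s x y = s (x + y) (x + y) - s (x - y) (x - y)
      - Complex.I • (s (x + Complex.I • y) (x + Complex.I • y)
        - s (x - Complex.I • y) (x - Complex.I • y)) := by
  simp only [map_add, map_sub, LinearMap.add_apply, LinearMap.sub_apply, sesq_smul_left, map_smul,
    Complex.star_def, Complex.conj_I, smul_add, smul_sub, smul_smul, neg_smul,
    smul_neg, Complex.I_mul_I]
  module

lemma sesq_eq_zero_of_diag (s : E →ₗ⋆[ℂ] E →ₗ[ℂ] F) (h : ∀ x, s x x = 0) : s = 0 := by
  ext x y
  have h₄ := sesq_polarization s x y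
  simp only [h, sub_self, smul_zero] at h₄
  exact (smul_eq_zero.1 h₄).resolve_left (by norm_num)

lemma star_sesq_of_isSelfAdjoint_diag [StarAddMonoid F] [StarModule ℂ F]
    (s : E →ₗ⋆[ℂ] E →ₗ[ℂ] F) (h : ∀ x, IsSelfAdjoint (s x x)) (x y : E) :
    star (s x y) = s y x := by
  have hreal := (h (x + y)).star_eq
  have himag := congrArg (Complex.I • ·) (h (x + Complex.I • y)).star_eq
  simp only [map_add, LinearMap.add_apply, star_add, (h _).star_eq, sesq_smul_left, map_smul,
    star_smul, star_neg, Complex.star_def, Complex.conj_I, smul_add, smul_neg, smul_smul,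
    Complex.I_mul_I, neg_smul, neg_neg, one_smul] at hreal himag
  linear_combination (norm := module) (2⁻¹ : ℂ) • hreal + (2⁻¹ : ℂ) • himag

end Sesquilinear

section Total

variable (A : Type*) [NonUnitalCStarAlgebra A] [PartialOrder A]
  {M : Type*} [NormedAddCommGroup M] [NormedSpace ℂ M] [SMul Aᵐᵒᵖ M] [CStarModule Aᵐᵒᵖ M]

/-- Only `0` is orthogonal to `s`: the form of density which the uniqueness arguments need, common
to norm density and to density in the two topologies `tau₁` and `tau₂`. -/
def IsTotal (s : Set M) : Prop :=
  ∀ z : M, (∀ x ∈ s, ip A z x = 0) → z = 0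

variable {A} {s : Set M}

lemma IsTotal.of_span (hs : IsTotal A (Submodule.span ℂ s : Set M)) : IsTotal A s := by
  refine fun z hz => hs z fun x hx => ?_
  induction hx using Submodule.span_induction with
  | zero => exact ip_zero_right A z
  | add x y _ _ hx hy => rw [ip_add_right, hx, hy, add_zero]
  | smul c x _ hx => rw [ip_smul_right, hx, smul_zero]
  | mem x hx => exact hz x hx

lemma IsTotal.ext_left (hs : IsTotal A s) {y z : M} (h : ∀ x ∈ s, ip A y x = ip A z x) : y = z :=
  sub_eq_zero.1 <| hs _ fun x hx => by rw [ip_sub_left, h x hx, sub_self]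

lemma IsTotal.ext_right (hs : IsTotal A s) {y z : M} (h : ∀ x ∈ s, ip A x y = ip A x z) : y = z :=
  hs.ext_left fun x hx => by rw [← star_ip, h x hx, star_ip]

lemma IsTotal.adjointable_eq_zero (hs : IsTotal A s) {T : adjointable A M}
    (h : ∀ x ∈ s, ∀ y ∈ s, ip A x (T.1 y) = 0) : T = 0 := by
  have hstar : ∀ x ∈ s, (star T).1 x = 0 := fun x hx =>
    hs _ fun y hy => by rw [← adjointable.isAdjointPair_star T, h x hx y hy]
  refine Subtype.ext (ContinuousLinearMap.ext fun z => hs.ext_right fun x hx => ?_)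
  rw [adjointable.isAdjointPair_star T, hstar x hx, ip_zero_left]
  exact (ip_zero_right A x).symm

lemma isTotal_of_dense [StarOrderedRing A] (hs : Dense s) : IsTotal A s := fun z hz =>
  eq_zero_of_ip_self (A := A) <|
    congrFun (Continuous.ext_on hs (ipL A z).continuous continuous_const hz) z

end Total

namespace CovariantDilation

variable {A B V G : Type*} [NonUnitalCStarAlgebra A] [PartialOrder A] [CStarAlgebra B]
  [AddCommGroup V] [Module ℂ V] [SMul Aᵐᵒᵖ V] [Group G]
  {β : G →* (B ≃⋆ₐ[ℂ] B)} {U : G →* (V ≃ₗ[ℂ] V)} {S : B →ₗ[ℂ] SesqForm A V} {s₁ : SesqForm A V}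
  {M : Type*} [NormedAddCommGroup M] [NormedSpace ℂ M] [SMul Aᵐᵒᵖ M] [CStarModule Aᵐᵒᵖ M]
  (d : CovariantDilation β U S M)

/-- The representation `π` of `B` as a ⋆-homomorphism into `𝓛_A(M)`. -/
def rep : B →⋆ₐ[ℂ] adjointable A M where
  __ := d.π.codRestrict (adjointable A M) fun b => (d.π_star b).isAdjointable
  map_star' b := (adjointable.star_eq_of_isAdjointPair (T := ⟨d.π b, _⟩) (d.π_star b)).symm

/-- The unitary representation `Ũ` of `G` as a homomorphism into `𝓛_A(M)`. -/
def unitaryRep : G →* adjointable A M :=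
  d.Ut.codRestrict (adjointable A M) fun g => (d.Ut_unitary g).isAdjointable

@[simp] lemma coe_rep (b : B) : (d.rep b).1 = d.π b := rfl

@[simp] lemma coe_unitaryRep (g : G) : (d.unitaryRep g).1 = d.Ut g := rfl

lemma unitaryRep_mul_unitaryRep_inv (g : G) : d.unitaryRep g * d.unitaryRep g⁻¹ = 1 := by
  rw [← map_mul, mul_inv_cancel, map_one]

lemma star_unitaryRep (g : G) : star (d.unitaryRep g) = d.unitaryRep g⁻¹ := by
  obtain ⟨-, T', -, hadj, -, hleft⟩ := d.Ut_unitary g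
  have hinv : T' = d.Ut g⁻¹ := left_inv_eq_right_inv hleft
    (congrArg Subtype.val (d.unitaryRep_mul_unitaryRep_inv g))
  subst hinv
  exact adjointable.star_eq_of_isAdjointPair hadj

/-- The commutant of `π(B)` and `Ũ(G)` in `𝓛_A(M)`. -/
def commutant : StarSubalgebra ℂ (adjointable A M) :=
  StarSubalgebra.centralizer ℂ (Set.range d.rep ∪ Set.range d.unitaryRep)

variable {d}

lemma mem_commutant_iff {D : adjointable A M} :
    D ∈ d.commutant ↔ (∀ b, Commute D (d.rep b)) ∧ ∀ g, Commute D (d.unitaryRep g) := by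
  simp only [commutant, StarSubalgebra.mem_centralizer_iff, Set.mem_union, or_imp, forall_and,
    Set.forall_mem_range, ← map_star, star_unitaryRep, commute_iff_eq, eq_comm (a := D * _)]
  exact ⟨fun h => ⟨h.1.1, h.1.2⟩, fun h => ⟨h, fun b => h.1 _, fun g => h.2 _⟩⟩

lemma extremalityCondition_iff : d.ExtremalityCondition ↔
    ∀ D ∈ d.commutant, (∀ v, ip A (d.J v) (D.1 (d.J v)) = 0) → D = 0 := by
  constructor
  · intro h D hD hJ
    obtain ⟨hπ, hU⟩ := mem_commutant_iff.1 hD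
    exact Subtype.ext (h D.1 D.2 (fun b => congrArg Subtype.val (hπ b).eq)
      (fun g => congrArg Subtype.val (hU g).eq) hJ)
  · intro h D hD hπ hU hJ
    exact congrArg Subtype.val (h ⟨D, hD⟩ (mem_commutant_iff.2
      ⟨fun b => Subtype.ext (hπ b).eq, fun g => Subtype.ext (hU g).eq⟩) hJ)

lemma ip_π_π (b c : B) (x y : M) : ip A (d.π b x) (d.π c y) = ip A x (d.π (star b * c) y) := by
  rw [map_mul, mul_apply_eq_comp, d.π_star (star b), star_star]

lemma ip_π_of_commute {D : adjointable A M} {b c : B} (hD : Commute D (d.rep c)) (x y : M) :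
    ip A (d.π b x) (D.1 (d.π c y)) = ip A x (d.π (star b * c) (D.1 y)) := by
  rw [← ip_π_π]
  exact congrArg (fun T : adjointable A M => ip A (d.π b x) (T.1 y)) hD.eq

lemma eq_zero_of_ip_generators (hd : IsTotal A (d.range : Set M)) {T : adjointable A M}
    (h : ∀ b v c w, ip A (d.π b (d.J v)) (T.1 (d.π c (d.J w))) = 0) : T = 0 := by
  refine hd.of_span.adjointable_eq_zero ?_
  rintro _ ⟨b, v, rfl⟩ _ ⟨c, w, rfl⟩
  exact h b v c w

variable (d)

/-- The vector forms `(v, w) ↦ ⟨Jv|TJw⟩`. -/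
def vectorForm : adjointable A M →ₗ[ℂ] SesqForm A V where
  toFun T :=
    ⟨LinearMap.mk₂'ₛₗ (starRingEnd ℂ) (RingHom.id ℂ) (fun v w => ip A (d.J v) (T.1 (d.J w)))
      (by simp) (by simp) (by simp) (by simp),
      fun v w a => by simp [d.J_module w a, T.2.1 _ a],
      fun v w a => by simp [d.J_module v a]⟩
  map_add' T R := by ext v w; simp
  map_smul' c T := by ext v w; simp

/-- The maps `b ↦ ⟨J · |π(b)DJ · ⟩`. For `D = 1` this is `S`, and the perturbations of `S` inside
the covariant completely positive maps come from the `D` in the commutant. -/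
def compress : adjointable A M →ₗ[ℂ] B →ₗ[ℂ] SesqForm A V :=
  LinearMap.mk₂ ℂ (fun D b => d.vectorForm (d.rep b * D)) (by simp [mul_add]) (by simp)
    (by simp [add_mul]) (by simp)

lemma compress_apply (D : adjointable A M) (b : B) (v w : V) :
    (d.compress D b).1 v w = ip A (d.J v) (d.π b (D.1 (d.J w))) := rfl

lemma compress_one : d.compress 1 = S := by
  ext b v w
  exact (d.dilates b v w).symm

variable {d}

lemma compress_isCP {D : adjointable A M} (hD : ∀ b, Commute D (d.rep b))
    (hpos : ∀ x, 0 ≤ ip A x (D.1 x)) : IsCP (d.compress D) := by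
  intro n b v
  convert hpos (∑ j, d.π (b j) (d.J (v j))) using 1
  simp only [map_sum, ip_sum_left, ip_sum_right, ip_π_of_commute (hD _), compress_apply]
  exact Finset.sum_comm

lemma compress_isCovariant {D : adjointable A M} (hD : ∀ g, Commute D (d.unitaryRep g)) :
    IsCovariant β U (d.compress D) := by
  intro g b v w
  have hcov : d.unitaryRep g * d.rep b = d.rep (β g b) * d.unitaryRep g :=
    Subtype.ext (d.π_covariant g b)
  have hconj : d.rep (β g b) * D = d.unitaryRep g * (d.rep b * D * d.unitaryRep g⁻¹) := by
    rw [mul_assoc, (hD g⁻¹).eq, ← mul_assoc, ← mul_assoc, hcov, mul_assoc (d.rep _),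
      unitaryRep_mul_unitaryRep_inv, mul_one]
  have hadj := adjointable.isAdjointPair_star (d.unitaryRep g)
  rw [star_unitaryRep] at hadj
  calc (d.compress D (β g b)).1 v w
      = ip A (d.J v) (d.Ut g (d.π b (D.1 (d.Ut g⁻¹ (d.J w))))) :=
        congrArg (fun T : adjointable A M => ip A (d.J v) (T.1 (d.J w))) hconj
    _ = ip A (d.J (U g⁻¹ v)) (d.π b (D.1 (d.J (U g⁻¹ w)))) := by
        rw [d.J_covariant, d.J_covariant]
        exact hadj _ _

lemma compress_mem_CP {D : adjointable A M} (hD : D ∈ d.commutant)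
    (hpos : ∀ x, 0 ≤ ip A x (D.1 x)) (hJ : ∀ v, ip A (d.J v) (D.1 (d.J v)) = s₁.1 v v) :
    d.compress D ∈ CP β U s₁ := by
  obtain ⟨hπ, hU⟩ := mem_commutant_iff.1 hD
  refine ⟨compress_isCP hπ hpos, compress_isCovariant hU, Subtype.ext (sub_eq_zero.1 ?_)⟩
  refine sesq_eq_zero_of_diag _ fun v => ?_
  rw [LinearMap.sub_apply, LinearMap.sub_apply, compress_apply, map_one, one_apply_eq_self, hJ,
    sub_self]

lemma compress_injOn (hd : IsTotal A (d.range : Set M)) :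
    Set.InjOn d.compress (d.commutant : Set (adjointable A M)) := by
  intro D hD D' hD' heq
  refine sub_eq_zero.1 (eq_zero_of_ip_generators hd fun b v c w => ?_)
  have hc := (mem_commutant_iff.1 (sub_mem hD hD')).1 c
  rw [ip_π_of_commute hc, AddSubgroupClass.coe_sub, sub_apply, map_sub,
    ip_sub_right, sub_eq_zero]
  exact congrArg (fun R : B →ₗ[ℂ] SesqForm A V => (R (star b * c)).1 v w) heq

variable [StarOrderedRing A] [CompleteSpace M]

lemma eq_zero_of_norm_le_one_of_mem_extremePoints (hS : S ∈ (CP β U s₁).extremePoints ℝ)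
    (hd : IsTotal A (d.range : Set M)) {D : adjointable A M} (hD : D ∈ d.commutant)
    (hsa : IsSelfAdjoint D) (hnorm : ‖D‖ ≤ 1) (hJ : ∀ v, ip A (d.J v) (D.1 (d.J v)) = 0) :
    D = 0 := by
  have hs₁ : ∀ v, s₁.1 v v = ip A (d.J v) (d.J v) := fun v => by
    rw [← hS.1.2.2, d.dilates, map_one, one_apply_eq_self]
  have hadd : d.compress (1 + D) ∈ CP β U s₁ :=
    compress_mem_CP (add_mem (one_mem _) hD)
      (fun x => by
        have hneg := adjointable.ip_apply_le_of_norm_le_one hsa.neg ((norm_neg D).trans_le hnorm) x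
        rw [NegMemClass.coe_neg, neg_apply, ← neg_one_smul ℂ, ip_smul_right, neg_one_smul] at hneg
        simpa using neg_le_iff_add_nonneg.1 hneg)
      (fun v => by simp [hJ, hs₁])
  have hsub : d.compress (1 - D) ∈ CP β U s₁ :=
    compress_mem_CP (sub_mem (one_mem _) hD)
      (fun x => by simpa using adjointable.ip_apply_le_of_norm_le_one hsa hnorm x)
      (fun v => by simp [hJ, hs₁])
  have hmid : S ∈ openSegment ℝ (d.compress (1 + D)) (d.compress (1 - D)) := by
    refine ⟨1 / 2, 1 / 2, by norm_num, by norm_num, by norm_num, ?_⟩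
    ext b v w
    change (1 / 2 : ℝ) • ip A (d.J v) (d.π b (d.J w + D.1 (d.J w))) +
      (1 / 2 : ℝ) • ip A (d.J v) (d.π b (d.J w - D.1 (d.J w))) = (S b).1 v w
    rw [d.dilates, map_add, map_sub, ip_add_right, ip_sub_right]
    module
  have heq : d.compress (1 + D) = d.compress 1 :=
    ((mem_extremePoints_iff_left.1 hS).2 _ hadd _ hsub hmid).trans d.compress_one.symm
  simpa using compress_injOn hd (add_mem (one_mem _) hD) (one_mem _) heq

lemma eq_zero_of_isSelfAdjoint_of_mem_extremePoints (hS : S ∈ (CP β U s₁).extremePoints ℝ)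
    (hd : IsTotal A (d.range : Set M)) {D : adjointable A M} (hD : D ∈ d.commutant)
    (hsa : IsSelfAdjoint D) (hJ : ∀ v, ip A (d.J v) (D.1 (d.J v)) = 0) : D = 0 := by
  by_contra hD_ne
  have hr : (((‖D‖⁻¹ : ℝ) : ℂ)) ≠ 0 := by simpa using hD_ne
  refine hD_ne ((smul_eq_zero.1 (eq_zero_of_norm_le_one_of_mem_extremePoints hS hd
    (D := ((‖D‖⁻¹ : ℝ) : ℂ) • D) (SMulMemClass.smul_mem _ hD) ?_ ?_ ?_)).resolve_left hr)
  · rw [isSelfAdjoint_iff, star_smul, hsa.star_eq, Complex.star_def, Complex.conj_ofReal]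
  · rw [norm_smul, Complex.norm_real, norm_inv, norm_norm]
    exact inv_mul_le_one
  · exact fun v => by simp [hJ v]

theorem extremalityCondition_of_mem_extremePoints (hS : S ∈ (CP β U s₁).extremePoints ℝ)
    (hd : IsTotal A (d.range : Set M)) : d.ExtremalityCondition := by
  refine extremalityCondition_iff.2 fun D hD hJ => ?_
  have hJ_star : ∀ v, ip A (d.J v) ((star D).1 (d.J v)) = 0 := fun v => by
    rw [← star_ip, ← adjointable.isAdjointPair_star, hJ, star_zero]
  have hD_star : star D ∈ d.commutant := star_mem hD
  have hre : D + star D = 0 :=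
    eq_zero_of_isSelfAdjoint_of_mem_extremePoints hS hd (add_mem hD hD_star)
      (IsSelfAdjoint.add_star_self D) fun v => by simp [hJ, hJ_star]
  have him : Complex.I • (D - star D) = 0 :=
    eq_zero_of_isSelfAdjoint_of_mem_extremePoints hS hd
      (SMulMemClass.smul_mem _ (sub_mem hD hD_star))
      (by simp [isSelfAdjoint_iff, ← smul_neg]) fun v => by simp [hJ, hJ_star]
  have hself : D = star D := sub_eq_zero.1 ((smul_eq_zero.1 him).resolve_left Complex.I_ne_zero)
  rw [← hself, ← two_smul ℂ] at hre
  exact (smul_eq_zero.1 hre).resolve_left two_ne_zero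

end CovariantDilation

section BoundedForm

variable {E F : Type*} [AddCommGroup E] [Module ℂ E] [SeminormedAddCommGroup F] [NormedSpace ℂ F]
  {s : E →ₗ⋆[ℂ] E →ₗ[ℂ] F} {p : Seminorm ℂ E} {c : ℝ}

lemma norm_sesq_le_of_seminorm_le_one (hs : ∀ x, ‖s x x‖ ≤ c * p x ^ 2) (hc : 0 ≤ c) {x y : E}
    (hx : p x ≤ 1) (hy : p y ≤ 1) : ‖s x y‖ ≤ 4 * c := by
  have hle : ∀ z, p z ≤ 2 → ‖s z z‖ ≤ 4 * c := fun z hz => by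
    refine (hs z).trans ?_
    nlinarith [pow_le_pow_left₀ (apply_nonneg p z) hz 2]
  have hIy : p (Complex.I • y) ≤ 1 := by rwa [map_smul_eq_mul, Complex.norm_I, one_mul]
  have hadd := hle (x + y) (by linarith [map_add_le_add p x y])
  have hsub := hle (x - y) (by linarith [map_sub_le_add p x y])
  have hIadd := hle (x + Complex.I • y) (by linarith [map_add_le_add p x (Complex.I • y)])
  have hIsub := hle (x - Complex.I • y) (by linarith [map_sub_le_add p x (Complex.I • y)])
  have hpol : ‖(4 : ℂ) • s x y‖ ≤ 16 * c := by
    rw [sesq_polarization]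
    have hI : ‖Complex.I • (s (x + Complex.I • y) (x + Complex.I • y)
        - s (x - Complex.I • y) (x - Complex.I • y))‖ ≤ 4 * c + 4 * c := by
      rw [norm_smul, Complex.norm_I, one_mul]
      exact norm_sub_le_of_le hIadd hIsub
    exact (norm_sub_le_of_le (norm_sub_le_of_le hadd hsub) hI).trans_eq (by ring)
  rw [norm_smul] at hpol
  norm_num at hpol
  linarith

lemma norm_sesq_le (hs : ∀ x, ‖s x x‖ ≤ c * p x ^ 2) (hc : 0 ≤ c) (x y : E) :
    ‖s x y‖ ≤ 4 * c * p x * p y := by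
  have hscaled : ∀ a > p x, ∀ b > p y, ‖s x y‖ ≤ 4 * c * (a * b) := fun a ha b hb => by
    have ha₀ : 0 < a := (apply_nonneg p x).trans_lt ha
    have hb₀ : 0 < b := (apply_nonneg p y).trans_lt hb
    have hunit := norm_sesq_le_of_seminorm_le_one hs hc (x := ((a⁻¹ : ℝ) : ℂ) • x)
      (y := ((b⁻¹ : ℝ) : ℂ) • y)
      (by rw [map_smul_eq_mul, Complex.norm_real, norm_inv, Real.norm_of_nonneg ha₀.le]
          exact inv_mul_le_one_of_le₀ ha.le ha₀.le)
      (by rw [map_smul_eq_mul, Complex.norm_real, norm_inv, Real.norm_of_nonneg hb₀.le]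
          exact inv_mul_le_one_of_le₀ hb.le hb₀.le)
    rw [sesq_smul_left, map_smul, norm_smul, norm_smul, norm_star, Complex.norm_real,
      Complex.norm_real, norm_inv, norm_inv, Real.norm_of_nonneg ha₀.le,
      Real.norm_of_nonneg hb₀.le, ← mul_assoc, ← mul_inv, inv_mul_le_iff₀ (by positivity)] at hunit
    exact hunit.trans_eq (mul_comm _ _)
  rw [mul_assoc]
  obtain rfl | hc₀ := hc.eq_or_lt
  · simpa using hscaled (p x + 1) (lt_add_one _) (p y + 1) (lt_add_one _)
  · have h4c : 0 < 4 * c := by positivity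
    exact (div_le_iff₀' h4c).1 <| le_mul_of_forall_lt₀ fun a ha b hb =>
      (div_le_iff₀' h4c).2 (hscaled a ha b hb)

end BoundedForm

section FreeForm

variable {A B V : Type*} [NonUnitalCStarAlgebra A] [CStarAlgebra B] [AddCommGroup V] [Module ℂ V]
  [SMul Aᵐᵒᵖ V]

/-- The form `(∑ b ⊗ v, ∑ c ⊗ w) ↦ ∑ R (b⋆ c) (v, w)` of Stinespring's construction, on the module
`B →₀ V` of formal sums of elementary tensors. -/
def freeForm (R : B →ₗ[ℂ] SesqForm A V) : (B →₀ V) →ₗ⋆[ℂ] (B →₀ V) →ₗ[ℂ] A :=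
  Finsupp.lsum ℂ fun b =>
    { toFun v := Finsupp.lsum ℂ fun c => (R (star b * c)).1 v
      map_add' v w := by ext; simp
      map_smul' c v := by ext; simp }

lemma freeForm_single (R : B →ₗ[ℂ] SesqForm A V) (b c : B) (v w : V) :
    freeForm R (.single b v) (.single c w) = (R (star b * c)).1 v w := by
  simp [freeForm]

lemma freeForm_apply (R : B →ₗ[ℂ] SesqForm A V) (x y : B →₀ V) :
    freeForm R x y =
      ∑ b ∈ x.support, ∑ c ∈ y.support, (R (star b * c)).1 (x b) (y c) := by
  simp [freeForm, Finsupp.sum]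

lemma freeForm_add (R R' : B →ₗ[ℂ] SesqForm A V) (x y : B →₀ V) :
    freeForm (R + R') x y = freeForm R x y + freeForm R' x y := by
  simp only [freeForm_apply, ← Finset.sum_add_distrib]
  rfl

lemma freeForm_smul (t : ℝ) (R : B →ₗ[ℂ] SesqForm A V) (x y : B →₀ V) :
    freeForm (t • R) x y = t • freeForm R x y := by
  simp only [freeForm_apply, Finset.smul_sum]
  rfl

lemma IsCP.freeForm_nonneg [PartialOrder A] {R : B →ₗ[ℂ] SesqForm A V} (hR : IsCP R)
    (x : B →₀ V) : 0 ≤ freeForm R x x := by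
  let e := x.support.equivFin.symm
  convert hR x.support.card (fun i => e i) (fun i => x (e i)) using 1
  simp only [freeForm_apply, ← Finset.sum_coe_sort x.support, ← e.sum_comp]

end FreeForm

section Representation

variable {A : Type*} [NonUnitalCStarAlgebra A] [PartialOrder A]
  {M : Type*} [NormedAddCommGroup M] [NormedSpace ℂ M] [SMul Aᵐᵒᵖ M] [CStarModule Aᵐᵒᵖ M]
  {E F : Type*} [AddCommGroup E] [Module ℂ E] [AddCommGroup F] [Module ℂ F]

variable (A) in
/-- The Riesz representation property for the functionals on the range of `Φ` which are bounded and
`A`-linear. They are given by their pull-backs along `Φ`, so that they need not be factored through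
the range. -/
def HasRepresentation (Φ : E →ₗ[ℂ] M) : Prop :=
  ∀ (f : E →ₗ[ℂ] A) (C : ℝ), 0 ≤ C → (∀ x y a, Φ y = op a • Φ x → f y = f x * a) →
    (∀ x, ‖f x‖ ≤ C * ‖Φ x‖) → ∃ m : M, ‖m‖ ≤ C ∧ ∀ x, f x = ip A m (Φ x)

lemma HasRepresentation.exists_linearMap {Φ : E →ₗ[ℂ] M} (hΦ : HasRepresentation A Φ)
    (hE : IsTotal A (Set.range Φ)) (q : F →ₗ⋆[ℂ] E →ₗ[ℂ] A) {C : F → ℝ} (hC : ∀ z, 0 ≤ C z)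
    (hq : ∀ z x y a, Φ y = op a • Φ x → q z y = q z x * a) (hbound : ∀ z x, ‖q z x‖ ≤ C z * ‖Φ x‖) :
    ∃ T : F →ₗ[ℂ] M, (∀ z, ‖T z‖ ≤ C z) ∧ ∀ z x, ip A (T z) (Φ x) = q z x := by
  choose T hT_norm hT using fun z => hΦ (q z) (C z) (hC z) (hq z) (hbound z)
  have hext {y z : M} (h : ∀ x, ip A y (Φ x) = ip A z (Φ x)) : y = z :=
    hE.ext_left (Set.forall_mem_range.2 h)
  refine ⟨⟨⟨T, fun z w => hext fun x => ?_⟩, fun c z => hext fun x => ?_⟩, hT_norm,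
    fun z x => (hT z x).symm⟩
  · rw [← hT, map_add, LinearMap.add_apply, hT, hT, ip_add_left]
  · rw [← hT, LinearMap.map_smulₛₗ, LinearMap.smul_apply, hT, RingHom.id_apply, ip_smul_left]
    rfl

lemma IsSelfDual.hasRepresentation_id (hM : IsSelfDual A M) :
    HasRepresentation A (LinearMap.id : M →ₗ[ℂ] M) := by
  intro f C hC hf hbound
  obtain ⟨m, hm⟩ := hM (f.mkContinuous C hbound) fun x a => hf x _ a rfl
  exact ⟨m, norm_le_of_norm_ip_le hC fun y => (congrArg norm (hm y)).symm.trans_le (hbound y), hm⟩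

variable [StarOrderedRing A]

lemma IsSelfDual.isAdjointable (hM : IsSelfDual A M) {T : M →L[ℂ] M} (hT : IsModuleMap A T) :
    IsAdjointable A T := by
  let q : M →ₗ⋆[ℂ] M →ₗ[ℂ] A := LinearMap.mk₂'ₛₗ (starRingEnd ℂ) (RingHom.id ℂ)
    (fun x y => ip A x (T y)) (by simp) (by simp) (by simp) (by simp)
  obtain ⟨T', hT'_norm, hT'⟩ := hM.hasRepresentation_id.exists_linearMap
    (fun z hz => ext_ip_right (A := A) fun y => by simpa using hz y ⟨y, rfl⟩) q
    (C := fun x => ‖T‖ * ‖x‖) (fun x => by positivity) (fun z x y a h => by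
      have : y = op a • x := h
      simp [q, this, hT x a]) (fun x y => by
      calc ‖ip A x (T y)‖ ≤ ‖x‖ * (‖T‖ * ‖y‖) :=
            (norm_ip_le A _ _).trans (by gcongr; exact T.le_opNorm y)
        _ = ‖T‖ * ‖x‖ * ‖y‖ := by ring)
  exact IsAdjointPair.isAdjointable (T' := T'.mkContinuous ‖T‖ hT'_norm) fun x y => (hT' x y).symm

theorem HasRepresentation.exists_adjointable {Φ : E →ₗ[ℂ] M} (hΦ : HasRepresentation A Φ)
    (hM : IsSelfDual A M) (hE : IsTotal A (Set.range Φ)) (q : E →ₗ⋆[ℂ] E →ₗ[ℂ] A) {C : ℝ}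
    (hC : 0 ≤ C) (hq : ∀ z x y a, Φ y = op a • Φ x → q z y = q z x * a)
    (hherm : ∀ x y, star (q x y) = q y x) (hbound : ∀ x y, ‖q x y‖ ≤ C * ‖Φ x‖ * ‖Φ y‖) :
    ∃ T : adjointable A M, ∀ x y, ip A (Φ x) (T.1 (Φ y)) = q x y := by
  obtain ⟨T, hT_norm, hT⟩ := hΦ.exists_linearMap hE q (fun x => by positivity) hq hbound
  have hext {y z : M} (h : ∀ x, ip A y (Φ x) = ip A z (Φ x)) : y = z :=
    hE.ext_left (Set.forall_mem_range.2 h)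
  have hT_act : ∀ x y a, Φ y = op a • Φ x → T y = op a • T x := fun x y a hxy => hext fun w => by
    rw [ip_act_left, hT, hT, ← hherm, hq w x y a hxy, star_mul, hherm]
  obtain ⟨D, hD_norm, hD⟩ := hΦ.exists_linearMap hE
    (LinearMap.mk₂'ₛₗ (starRingEnd ℂ) (RingHom.id ℂ) (fun (z : M) x => ip A z (T x))
      (by simp) (by simp) (by simp) (by simp))
    (C := fun z => C * ‖z‖) (fun z => by positivity)
    (fun z x y a hxy => by simp [hT_act x y a hxy])
    (fun z x => by
      calc ‖ip A z (T x)‖ ≤ ‖z‖ * (C * ‖Φ x‖) :=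
            (norm_ip_le A _ _).trans (by gcongr; exact hT_norm x)
        _ = C * ‖z‖ * ‖Φ x‖ := by ring)
  obtain ⟨-, D', -, hD'⟩ := hM.isAdjointable (T := D.mkContinuous C hD_norm) fun z a =>
    hext fun x => by
      rw [LinearMap.mkContinuous_apply, LinearMap.mkContinuous_apply, ip_act_left, hD, hD]
      simp only [LinearMap.mk₂'ₛₗ_apply, ip_act_left]
  refine ⟨⟨D', hD'.symm.isAdjointable⟩, fun x y => ?_⟩
  calc ip A (Φ x) (D' (Φ y)) = ip A (D (Φ x)) (Φ y) := hD'.symm _ _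
    _ = ip A (Φ x) (T y) := hD _ _
    _ = q x y := by rw [← star_ip, hT, hherm]

end Representation

namespace CovariantDilation

variable {A B V G : Type*} [NonUnitalCStarAlgebra A] [PartialOrder A] [CStarAlgebra B]
  [AddCommGroup V] [Module ℂ V] [SMul Aᵐᵒᵖ V] [Group G]
  {β : G →* (B ≃⋆ₐ[ℂ] B)} {U : G →* (V ≃ₗ[ℂ] V)} {S R : B →ₗ[ℂ] SesqForm A V} {s₁ : SesqForm A V}
  {M : Type*} [NormedAddCommGroup M] [NormedSpace ℂ M] [SMul Aᵐᵒᵖ M] [CStarModule Aᵐᵒᵖ M]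
  (d : CovariantDilation β U S M)

/-- The map `∑ b ⊗ v ↦ ∑ π(b)Jv`, which pulls the inner product of `M` back to `freeForm S`. -/
def gen : (B →₀ V) →ₗ[ℂ] M :=
  Finsupp.lsum ℂ fun b => (d.π b).toLinearMap ∘ₗ d.J

@[simp] lemma gen_single (b : B) (v : V) : d.gen (.single b v) = d.π b (d.J v) := by
  simp [gen]

lemma range_gen : LinearMap.range d.gen = d.range := by
  refine le_antisymm ?_ (Submodule.span_le.2 ?_)
  · rintro _ ⟨x, rfl⟩
    induction x using Finsupp.induction_linear with
    | zero => simp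
    | add x y hx hy => rw [map_add]; exact add_mem hx hy
    | single b v => exact Submodule.subset_span ⟨b, v, d.gen_single b v⟩
  · rintro _ ⟨b, v, rfl⟩
    exact ⟨_, d.gen_single b v⟩

lemma denseRange_gen (hd : d.IsMinimal) : DenseRange d.gen := by
  rwa [DenseRange, ← LinearMap.coe_range, range_gen]

lemma ip_gen (x y : B →₀ V) : ip A (d.gen x) (d.gen y) = freeForm S x y := by
  simp only [gen, Finsupp.lsum_apply, Finsupp.sum, freeForm_apply, ip_sum_left, ip_sum_right,
    d.dilates, ← ip_π_π]
  exact Finset.sum_comm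

lemma mem_commutant_of_density (hd : IsTotal A (d.range : Set M)) (hR : IsCovariant β U R)
    {D : adjointable A M} (hD : ∀ b v c w,
      ip A (d.π b (d.J v)) (D.1 (d.π c (d.J w))) = (R (star b * c)).1 v w) :
    D ∈ d.commutant := by
  have hcomm {T : adjointable A M}
      (hT : ∀ b v c w, ip A (d.π b (d.J v)) (D.1 (T.1 (d.π c (d.J w)))) =
        ip A ((star T).1 (d.π b (d.J v))) (D.1 (d.π c (d.J w)))) : Commute D T :=
    sub_eq_zero.1 <| eq_zero_of_ip_generators hd fun b v c w => by
      have := adjointable.isAdjointPair_star T (d.π b (d.J v)) (D.1 (d.π c (d.J w)))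
      rw [← hT, eq_comm, ← sub_eq_zero, ← ip_sub_right] at this
      exact this
  refine mem_commutant_iff.2 ⟨fun a => hcomm fun b v c w => ?_, fun g => hcomm fun b v c w => ?_⟩
  · rw [← map_star, coe_rep, coe_rep, ← mul_apply_eq_comp (d.π a),
      ← mul_apply_eq_comp (d.π (star a)), ← map_mul, ← map_mul, hD, hD, star_mul, star_star,
      mul_assoc]
  · rw [star_unitaryRep, coe_unitaryRep, coe_unitaryRep, ← mul_apply_eq_comp (d.Ut g),
      ← mul_apply_eq_comp (d.Ut g⁻¹), d.π_covariant, d.π_covariant, mul_apply_eq_comp,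
      mul_apply_eq_comp, ← d.J_covariant, ← d.J_covariant, hD, hD]
    have hβ : β g (β g⁻¹ b) = b := by
      change (β g * β g⁻¹) b = b
      rw [← map_mul, mul_inv_cancel, map_one]
      rfl
    have hU : U g⁻¹ (U g w) = w := by
      change (U g⁻¹ * U g) w = w
      rw [← map_mul, inv_mul_cancel, map_one]
      rfl
    have := hR g (star (β g⁻¹ b) * c) v (U g w)
    rwa [map_mul, map_star, hβ, hU] at this

variable [StarOrderedRing A]

lemma exists_gen_eq_act_and_freeForm_eq (x : B →₀ V) (a : A) : ∃ y, d.gen y = op a • d.gen x ∧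
    ∀ (R : B →ₗ[ℂ] SesqForm A V) (z : B →₀ V), freeForm R z y = freeForm R z x * a := by
  induction x using Finsupp.induction_linear with
  | zero => exact ⟨0, by simpa using ((actL A a : M →L[ℂ] M).map_zero).symm, by simp⟩
  | add x x' hx hx' =>
    obtain ⟨y, hy, hRy⟩ := hx
    obtain ⟨y', hy', hRy'⟩ := hx'
    refine ⟨y + y', ?_, fun R z => by rw [map_add, map_add, hRy, hRy', add_mul]⟩
    rw [map_add, map_add, hy, hy']
    exact ((actL A a : M →L[ℂ] M).map_add _ _).symm
  | single c w =>
    refine ⟨.single c (op a • w), by simp [d.J_module w a, d.π_module c _ a], fun R z => ?_⟩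
    induction z using Finsupp.induction_linear with
    | zero => simp
    | add z z' hz hz' => simp only [map_add, LinearMap.add_apply, hz, hz', add_mul]
    | single b v => rw [freeForm_single, freeForm_single, (R _).2.1]

lemma exists_gen_eq_act (x : B →₀ V) (a : A) : ∃ y, d.gen y = op a • d.gen x :=
  (d.exists_gen_eq_act_and_freeForm_eq x a).imp fun _ h => h.1

lemma norm_freeForm_le_of_dominated {c : ℝ} (hc : 0 ≤ c) (hR : IsCP R)
    (hRS : ∀ x, freeForm R x x ≤ c • freeForm S x x) (x y : B →₀ V) :
    ‖freeForm R x y‖ ≤ 4 * c * ‖d.gen x‖ * ‖d.gen y‖ := by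
  refine norm_sesq_le (p := (normSeminorm ℂ M).comp d.gen) (fun x => ?_) hc x y
  calc ‖freeForm R x x‖ ≤ ‖c • freeForm S x x‖ :=
        CStarAlgebra.norm_le_norm_of_nonneg_of_le (hR.freeForm_nonneg x) (hRS x)
    _ = c * ‖d.gen x‖ ^ 2 := by
        rw [norm_smul, Real.norm_of_nonneg hc, norm_sq_eq_norm_ip A, d.ip_gen]

lemma freeForm_act_of_dominated {c : ℝ} (hc : 0 ≤ c) (hR : IsCP R)
    (hRS : ∀ x, freeForm R x x ≤ c • freeForm S x x) {x y : B →₀ V} {a : A}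
    (hxy : d.gen y = op a • d.gen x) (z : B →₀ V) : freeForm R z y = freeForm R z x * a := by
  obtain ⟨y', hy', hRy'⟩ := d.exists_gen_eq_act_and_freeForm_eq x a
  have hnull : freeForm R z (y - y') = 0 := by
    simpa [hxy, hy'] using d.norm_freeForm_le_of_dominated hc hR hRS z (y - y')
  rw [← hRy', ← sub_eq_zero, ← map_sub, hnull]

theorem exists_density (hM : IsSelfDual A M) (hd : IsTotal A (d.range : Set M))
    (hrep : HasRepresentation A d.gen) {c : ℝ} (hc : 0 ≤ c) (hR : IsCP R)
    (hRS : ∀ x, freeForm R x x ≤ c • freeForm S x x) :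
    ∃ D : adjointable A M, ∀ b v c w,
      ip A (d.π b (d.J v)) (D.1 (d.π c (d.J w))) = (R (star b * c)).1 v w := by
  obtain ⟨D, hD⟩ := hrep.exists_adjointable hM (by rwa [← LinearMap.coe_range, range_gen])
    (freeForm R) (by positivity) (fun z x y a hxy => d.freeForm_act_of_dominated hc hR hRS hxy z)
    (star_sesq_of_isSelfAdjoint_diag _ fun x => (hR.freeForm_nonneg x).isSelfAdjoint)
    (d.norm_freeForm_le_of_dominated hc hR hRS)
  exact ⟨D, fun b v c w => by simpa [freeForm_single] using hD (.single b v) (.single c w)⟩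

theorem mem_extremePoints_of_extremalityCondition (hS : S ∈ CP β U s₁) (hM : IsSelfDual A M)
    (hd : IsTotal A (d.range : Set M)) (hrep : HasRepresentation A d.gen)
    (hext : d.ExtremalityCondition) : S ∈ (CP β U s₁).extremePoints ℝ := by
  refine mem_extremePoints_iff_left.2 ⟨hS, ?_⟩
  rintro R hR R' hR' ⟨t, t', ht, ht', -, h⟩
  have hRS : ∀ x, freeForm R x x ≤ t⁻¹ • freeForm S x x := fun x => by
    rw [← h, freeForm_add, freeForm_smul, freeForm_smul, smul_add, inv_smul_smul₀ ht.ne']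
    exact le_add_of_nonneg_right
      (smul_nonneg (inv_nonneg.2 ht.le) (smul_nonneg ht'.le (hR'.1.freeForm_nonneg x)))
  obtain ⟨D, hD⟩ := d.exists_density hM hd hrep (inv_nonneg.2 ht.le) hR.1 hRS
  have hD_J : ∀ b v w, ip A (d.J v) (D.1 (d.π b (d.J w))) = (R b).1 v w := fun b v w => by
    simpa using hD 1 v b w
  have hD_one : D = 1 := sub_eq_zero.1 <| extremalityCondition_iff.1 hext (D - 1)
    (sub_mem (d.mem_commutant_of_density hd hR.2.1 hD) (one_mem _)) fun v => by
      have hR_one : ip A (d.J v) (D.1 (d.J v)) = s₁.1 v v := by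
        rw [← hR.2.2, ← hD_J, map_one d.π]; rfl
      have hS_one : ip A (d.J v) (d.J v) = s₁.1 v v := by
        rw [← hS.2.2, d.dilates, map_one d.π]; rfl
      calc ip A (d.J v) ((D - 1).1 (d.J v)) = ip A (d.J v) (D.1 (d.J v) - d.J v) := rfl
        _ = 0 := by rw [ip_sub_right, hR_one, hS_one, sub_self]
  ext b v w
  rw [← hD_J, hD_one, d.dilates]
  rfl

end CovariantDilation

section DenseRange

variable {A : Type*} [NonUnitalCStarAlgebra A] [PartialOrder A] [StarOrderedRing A]
  {M : Type*} [NormedAddCommGroup M] [NormedSpace ℂ M] [SMul Aᵐᵒᵖ M] [CStarModule Aᵐᵒᵖ M]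
  {E : Type*} [AddCommGroup E] [Module ℂ E] {Φ : E →ₗ[ℂ] M}

theorem IsSelfDual.hasRepresentation_of_denseRange (hM : IsSelfDual A M)
    (hact : ∀ x (a : A), ∃ y, Φ y = op a • Φ x) (hΦ : DenseRange Φ) : HasRepresentation A Φ := by
  intro f C hC hf hbound
  have hext : ∀ x, f.extendOfNorm Φ (Φ x) = f x := LinearMap.extendOfNorm_eq hΦ ⟨C, hbound⟩
  have hmodule : ∀ (z : M) (a : A), f.extendOfNorm Φ (op a • z) = f.extendOfNorm Φ z * a := by
    intro z a
    refine congrFun (hΦ.equalizer ((f.extendOfNorm Φ).continuous.comp (actL A a).continuous)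
      ((f.extendOfNorm Φ).continuous.mul continuous_const) (funext fun x => ?_)) z
    obtain ⟨y, hy⟩ := hact x a
    change f.extendOfNorm Φ (op a • Φ x) = f.extendOfNorm Φ (Φ x) * a
    rw [← hy, hext, hext, hf x y a hy]
  obtain ⟨m, hm_norm, hm⟩ := hM.hasRepresentation_id (f.extendOfNorm Φ).toLinearMap C hC
    (fun x y a hxy => (congrArg _ hxy).trans (hmodule x a))
    (LinearMap.norm_extendOfNorm_apply_le hΦ C hbound)
  exact ⟨m, hm_norm, fun x => (hext x).symm.trans (hm (Φ x))⟩

end DenseRange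

section Approximation

lemma exists_regularized_inverse {X : Type*} [CStarAlgebra X] {T : X} (hT : IsSelfAdjoint T)
    {s : ℝ} (hs : 0 < s) :
    ∃ R h : X, T * R + h = 1 ∧ IsSelfAdjoint h ∧ ‖T * R‖ ≤ 1 ∧ ‖h * T * h‖ ≤ s := by
  -- Tikhonov regularization: `R = T (T² + s²)⁻¹` and `h = s² (T² + s²)⁻¹`
  let r (x : ℝ) := x / (x ^ 2 + s ^ 2)
  let h (x : ℝ) := s ^ 2 / (x ^ 2 + s ^ 2)
  have hden (x : ℝ) : 0 < x ^ 2 + s ^ 2 := by positivity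
  have hr : Continuous r := continuous_id.div (by fun_prop) fun x => (hden x).ne'
  have hh : Continuous h := continuous_const.div (by fun_prop) fun x => (hden x).ne'
  have hxr (x : ℝ) : x * r x = 1 - h x := by
    rw [eq_sub_iff_add_eq, mul_div_assoc', ← sq, ← add_div, div_self (hden x).ne']
  have hh₀ (x : ℝ) : 0 ≤ h x := by positivity
  have hh₁ (x : ℝ) : h x ≤ 1 := div_le_one_of_le₀ (by nlinarith) (hden x).le
  have hxh (x : ℝ) : |x| * h x ≤ s := by
    rw [mul_div_assoc', div_le_iff₀ (hden x)]
    nlinarith [sq_abs x,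
      mul_nonneg hs.le (add_nonneg (sq_nonneg (|x| - s)) (mul_nonneg hs.le (abs_nonneg x)))]
  have hTr : T * cfc r T = cfc (fun x => 1 - h x) T := by
    conv_lhs => enter [1]; rw [← cfc_id' ℝ T]
    rw [← cfc_mul (fun x => x) r T continuousOn_id hr.continuousOn]
    exact cfc_congr fun x _ => hxr x
  refine ⟨cfc r T, cfc h T, ?_, cfc_predicate h T, ?_, ?_⟩
  · rw [hTr, ← cfc_add T (fun x => 1 - h x) h (by fun_prop) hh.continuousOn, ← cfc_one ℝ T]
    exact cfc_congr fun x _ => sub_add_cancel 1 (h x)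
  · rw [hTr]
    exact norm_cfc_le zero_le_one fun x _ =>
      abs_le.2 ⟨by linarith [hh₁ x], by linarith [hh₀ x]⟩
  · conv_lhs => enter [1, 1, 2]; rw [← cfc_id' ℝ T]
    rw [← cfc_mul h (fun x => x) T hh.continuousOn continuousOn_id,
      ← cfc_mul (fun x => h x * x) h T (by fun_prop) hh.continuousOn]
    refine norm_cfc_le hs.le fun x _ => ?_
    rw [Real.norm_eq_abs, mul_assoc, abs_mul, abs_mul, abs_of_nonneg (hh₀ x)]
    exact (mul_le_of_le_one_left (mul_nonneg (abs_nonneg x) (hh₀ x)) (hh₁ x)).trans (hxh x)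

variable {A : Type*} [NonUnitalCStarAlgebra A] [PartialOrder A] [StarOrderedRing A]
  {M : Type*} [NormedAddCommGroup M] [NormedSpace ℂ M] [SMul Aᵐᵒᵖ M] [CStarModule Aᵐᵒᵖ M]

variable (A) in
/-- The bounded linear map `|x⟩⟨x|`, mapping `y` to `x⟨x|y⟩`. -/
def rankOneL (x : M) : M →L[ℂ] M :=
  LinearMap.mkContinuous
    { toFun := fun y => op (ip A x y) • x
      map_add' := fun y z => ext_ip_left (A := A) fun w => by
        simp only [ip_add_right, ip_act_right, mul_add]
      map_smul' := fun c y => ext_ip_left (A := A) fun w => by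
        simp only [ip_smul_right, ip_act_right, mul_smul_comm, RingHom.id_apply] }
    (‖x‖ * ‖x‖) fun y => (norm_act_le A x _).trans (by
      calc ‖ip A x y‖ * ‖x‖ ≤ ‖x‖ * ‖y‖ * ‖x‖ := by gcongr; exact norm_ip_le A x y
        _ = ‖x‖ * ‖x‖ * ‖y‖ := by ring)

lemma rankOneL_apply (x y : M) : rankOneL A x y = op (ip A x y) • x := rfl

lemma isAdjointPair_rankOneL (x : M) : IsAdjointPair A (rankOneL A x) (rankOneL A x) :=
  fun y z => by simp [rankOneL_apply]

variable (A) in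
/-- The operator `|x⟩⟨x|` as an element of `𝓛_A(M)`. -/
def rankOne (x : M) : adjointable A M :=
  ⟨rankOneL A x, (isAdjointPair_rankOneL x).isAdjointable⟩

lemma isSelfAdjoint_rankOne (x : M) : IsSelfAdjoint (rankOne A x) :=
  adjointable.isSelfAdjoint_iff.2 (isAdjointPair_rankOneL x)

lemma mul_rankOne_mul_star (T : adjointable A M) (x : M) :
    T * rankOne A x * star T = rankOne A (T.1 x) :=
  Subtype.ext <| ContinuousLinearMap.ext fun y => by
    change T.1 (op (ip A x ((star T).1 y)) • x) = op (ip A (T.1 x) y) • T.1 x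
    rw [T.2.1, (adjointable.isAdjointPair_star T).symm x y]

lemma sum_rankOne_apply {ι : Type*} (t : Finset ι) (u : ι → M) (y : M) :
    (∑ i ∈ t, rankOne A (u i)).1 y = ∑ i ∈ t, op (ip A (u i) y) • u i := by
  rw [AddSubmonoidClass.coe_finsetSum, sum_apply]
  rfl

lemma norm_sq_le_norm_sum_rankOne {ι : Type*} {t : Finset ι} (u : ι → M) {i : ι} (hi : i ∈ t) :
    ‖u i‖ ^ 2 ≤ ‖∑ j ∈ t, rankOne A (u j)‖ := by
  set T := ∑ j ∈ t, rankOne A (u j)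
  have hT : ip A (u i) (T.1 (u i)) = ∑ j ∈ t, star (ip A (u j) (u i)) * ip A (u j) (u i) := by
    simp only [T, sum_rankOne_apply, ip_sum_right, ip_act_right, star_ip]
  have hle : star (ip A (u i) (u i)) * ip A (u i) (u i) ≤ ip A (u i) (T.1 (u i)) := by
    rw [hT]
    exact Finset.single_le_sum (f := fun j => star (ip A (u j) (u i)) * ip A (u j) (u i))
      (fun j _ => star_mul_self_nonneg _) hi
  obtain h₀ | h₀ := (norm_nonneg (u i)).eq_or_lt
  · simp [← h₀]
  · refine le_of_mul_le_mul_right ?_ (pow_pos h₀ 2)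
    calc ‖u i‖ ^ 2 * ‖u i‖ ^ 2 = ‖star (ip A (u i) (u i)) * ip A (u i) (u i)‖ := by
          rw [CStarRing.norm_star_mul_self, norm_sq_eq_norm_ip A]
      _ ≤ ‖ip A (u i) (T.1 (u i))‖ :=
          CStarAlgebra.norm_le_norm_of_nonneg_of_le (star_mul_self_nonneg _) hle
      _ ≤ ‖u i‖ * (‖T‖ * ‖u i‖) :=
          (norm_ip_le A _ _).trans (by gcongr; exact T.1.le_opNorm _)
      _ = ‖T‖ * ‖u i‖ ^ 2 := by ring

variable {E : Type*} [AddCommGroup E] [Module ℂ E] {Φ : E →ₗ[ℂ] M}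

lemma exists_norm_sub_ip_le [CompleteSpace M] (hact : ∀ x (a : A), ∃ y, Φ y = op a • Φ x)
    {f : E →ₗ[ℂ] A} {C : ℝ} (hC : 0 ≤ C) (hf : ∀ x y a, Φ y = op a • Φ x → f y = f x * a)
    (hbound : ∀ x, ‖f x‖ ≤ C * ‖Φ x‖) (t : Finset E) {s : ℝ} (hs : 0 < s) :
    ∃ m : M, ‖m‖ ≤ C ∧ ∀ x ∈ t, ‖f x - ip A m (Φ x)‖ ≤ C * √s := by
  set T := ∑ x ∈ t, rankOne A (Φ x)
  have hT : IsSelfAdjoint T := isSelfAdjoint_sum _ fun x _ => isSelfAdjoint_rankOne (Φ x)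
  obtain ⟨R, h, hTR, hh, hTR_norm, hhTh⟩ := exists_regularized_inverse hT hs
  have hh_sub (x : M) : h.1 x = x - T.1 (R.1 x) :=
    congrArg (fun D : adjointable A M => D.1 x) (eq_sub_of_add_eq' hTR)
  have hh_norm : ∀ x ∈ t, ‖h.1 (Φ x)‖ ≤ √s := fun x hx => by
    have hsum : h * T * h = ∑ x ∈ t, rankOne A (h.1 (Φ x)) := by
      nth_rw 2 [← hh.star_eq]
      simp only [T, Finset.mul_sum, Finset.sum_mul, mul_rankOne_mul_star]
    rw [hsum] at hhTh
    exact Real.le_sqrt_of_sq_le ((norm_sq_le_norm_sum_rankOne (fun z => h.1 (Φ z)) hx).trans hhTh)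
  -- `⟨m|y⟩ = f(TRy)`, so that the error of `m` at `x` is `f` at `(1 - TR)x = hx`
  let m : M := ∑ x ∈ t, op (star (f x)) • (star R).1 (Φ x)
  have hm : ∀ y, ∃ e, Φ e = T.1 (R.1 y) ∧ ip A m y = f e := fun y => by
    choose e he using fun x => hact x (ip A (Φ x) (R.1 y))
    refine ⟨∑ x ∈ t, e x, ?_, ?_⟩
    · rw [map_sum, sum_rankOne_apply]
      exact Finset.sum_congr rfl fun x _ => he x
    · rw [map_sum, ip_sum_left]
      refine Finset.sum_congr rfl fun x _ => ?_
      rw [ip_act_left, star_star, ← adjointable.isAdjointPair_star, hf x (e x) _ (he x)]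
  refine ⟨m, norm_le_of_norm_ip_le (A := A) hC fun y => ?_, fun x hx => ?_⟩
  · obtain ⟨e, he, hme⟩ := hm y
    have hTRy : ‖T.1 (R.1 y)‖ ≤ ‖y‖ := (T * R).1.le_of_opNorm_le hTR_norm y |>.trans_eq (one_mul _)
    rw [hme]
    exact (hbound e).trans (by rw [he]; gcongr)
  · obtain ⟨e, he, hme⟩ := hm (Φ x)
    rw [hme, ← map_sub]
    refine (hbound _).trans ?_
    rw [map_sub, he, ← hh_sub]
    gcongr
    exact hh_norm x hx

end Approximation

section WeakLimits

open InnerProductSpace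

lemma exists_tendsto_of_eventually_norm_le {E ι : Type*} [SeminormedAddCommGroup E] [ProperSpace E]
    {l : Ultrafilter ι} {f : ι → E} {C : ℝ} (hf : ∀ᶠ i in l, ‖f i‖ ≤ C) :
    ∃ z, ‖z‖ ≤ C ∧ Tendsto f l (𝓝 z) := by
  obtain ⟨z, hz, hfz⟩ := (isCompact_closedBall (0 : E) C).ultrafilter_le_nhds (l.map f)
    (le_principal_iff.2 (hf.mono fun i hi => mem_closedBall_zero_iff.2 hi))
  exact ⟨z, mem_closedBall_zero_iff.1 hz, hfz⟩

variable {H ι : Type*} [NormedAddCommGroup H] [InnerProductSpace ℂ H] [CompleteSpace H]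
  {l : Ultrafilter ι}

lemma exists_inner_eq_of_norm_le {C : ℝ} (hC : 0 ≤ C) (q : H →ₗ⋆[ℂ] H →ₗ[ℂ] ℂ)
    (hq : ∀ ξ η, ‖q ξ η‖ ≤ C * ‖ξ‖ * ‖η‖) :
    ∃ T : H →L[ℂ] H, ‖T‖ ≤ C ∧ ∀ ξ η, ⟪ξ, T η⟫_ℂ = q ξ η := by
  let T := ContinuousLinearMap.adjoint
    (continuousLinearMapOfBilin (LinearMap.mkContinuous₂ q C hq))
  have hT ξ η : ⟪ξ, T η⟫_ℂ = q ξ η := by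
    rw [ContinuousLinearMap.adjoint_inner_right, continuousLinearMapOfBilin_apply,
      LinearMap.mkContinuous₂_apply]
  refine ⟨T, T.opNorm_le_bound hC fun η => ?_, hT⟩
  rw [← innerSL_apply_norm ℂ]
  refine ContinuousLinearMap.opNorm_le_bound _ (by positivity) fun ξ => ?_
  rw [innerSL_apply_apply, norm_inner_symm, hT]
  exact (hq ξ η).trans_eq (mul_right_comm C _ _)

theorem exists_tendsto_inner_of_eventually_norm_le {T : ι → H →L[ℂ] H} {C : ℝ} (hC : 0 ≤ C)
    (hT : ∀ᶠ i in l, ‖T i‖ ≤ C) :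
    ∃ T₀ : H →L[ℂ] H, ‖T₀‖ ≤ C ∧ ∀ ξ η, Tendsto (fun i => ⟪ξ, T i η⟫_ℂ) l (𝓝 ⟪ξ, T₀ η⟫_ℂ) := by
  have hbound ξ η : ∀ᶠ i in l, ‖⟪ξ, T i η⟫_ℂ‖ ≤ C * ‖ξ‖ * ‖η‖ := hT.mono fun i hi =>
    calc ‖⟪ξ, T i η⟫_ℂ‖ ≤ ‖ξ‖ * ‖T i η‖ := norm_inner_le_norm _ _
      _ ≤ ‖ξ‖ * (C * ‖η‖) := by gcongr; exact (T i).le_of_opNorm_le hi η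
      _ = C * ‖ξ‖ * ‖η‖ := by ring
  choose q hq_norm hq using fun ξ η => exists_tendsto_of_eventually_norm_le (hbound ξ η)
  have hq_eq {ξ η z} (h : Tendsto (fun i => ⟪ξ, T i η⟫_ℂ) l (𝓝 z)) : q ξ η = z :=
    tendsto_nhds_unique (hq ξ η) h
  obtain ⟨T₀, hT₀, hT₀q⟩ := exists_inner_eq_of_norm_le hC
    (LinearMap.mk₂'ₛₗ (starRingEnd ℂ) (RingHom.id ℂ) q
      (fun ξ ξ' η => hq_eq (by simpa only [inner_add_left] using (hq ξ η).add (hq ξ' η)))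
      (fun c ξ η => hq_eq (by
        simpa only [inner_smul_left, smul_eq_mul] using (hq ξ η).const_mul (starRingEnd ℂ c)))
      (fun ξ η η' => hq_eq (by
        simpa only [map_add, inner_add_right] using (hq ξ η).add (hq ξ η')))
      (fun c ξ η => hq_eq (by
        simpa only [map_smul, inner_smul_right, smul_eq_mul, RingHom.id_apply]
          using (hq ξ η).const_mul c))) hq_norm
  exact ⟨T₀, hT₀, fun ξ η => (hT₀q ξ η).symm ▸ hq ξ η⟩

lemma commute_of_tendsto_inner {l : Filter ι} [l.NeBot] {T : ι → H →L[ℂ] H} {T₀ R : H →L[ℂ] H}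
    (hT : ∀ ξ η, Tendsto (fun i => ⟪ξ, T i η⟫_ℂ) l (𝓝 ⟪ξ, T₀ η⟫_ℂ)) (hR : ∀ i, Commute R (T i)) :
    Commute R T₀ := by
  refine ContinuousLinearMap.ext fun η => ext_inner_left ℂ fun ξ => ?_
  have hRT i : ⟪star R ξ, T i η⟫_ℂ = ⟪ξ, T i (R η)⟫_ℂ := by
    rw [ContinuousLinearMap.star_eq_adjoint, ContinuousLinearMap.adjoint_inner_left]
    exact congrArg (fun Q : H →L[ℂ] H => ⟪ξ, Q η⟫_ℂ) (hR i)
  calc ⟪ξ, R (T₀ η)⟫_ℂ = ⟪star R ξ, T₀ η⟫_ℂ := (ContinuousLinearMap.adjoint_inner_left R _ _).symm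
    _ = ⟪ξ, T₀ (R η)⟫_ℂ := tendsto_nhds_unique (hT _ _) ((hT ξ (R η)).congr fun i => (hRT i).symm)

end WeakLimits

section WeakTopologies

variable {A M : Type*} [NonUnitalCStarAlgebra A] [PartialOrder A] [NormedAddCommGroup M]
  [NormedSpace ℂ M] [SMul Aᵐᵒᵖ M] [CStarModule Aᵐᵒᵖ M]

lemma map_ip_self_nonneg (φ : A →ₚ[ℂ] ℂ) (x : M) : 0 ≤ φ (ip A x x) :=
  map_nonneg φ (ip_self_nonneg A x)

lemma map_ip_self_eq_zero_of_dense_tau₁ {φ : A →ₚ[ℂ] ℂ} (hφ : IsNormalMap φ) {s : Set M}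
    (hs : @Dense M (tau₁ A M) s) {z : M} (hz : ∀ x ∈ s, ip A z x = 0) : φ (ip A z z) = 0 := by
  have hre (x : M) : 0 ≤ (φ (ip A x x)).re := (Complex.le_def.1 (map_ip_self_nonneg φ x)).1
  by_contra hne
  have hpos : 0 < (φ (ip A z z)).re := (hre z).lt_of_ne fun h =>
    hne (Complex.ext h.symm (Complex.le_def.1 (map_ip_self_nonneg φ z)).2.symm)
  obtain ⟨x, hx, hxs⟩ := (@dense_iff_inter_open M (tau₁ A M) _).1 hs
    {x | √(φ (ip A (x - z) (x - z))).re < √(φ (ip A z z)).re}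
    (TopologicalSpace.isOpen_generateFrom_of_mem ⟨φ, z, _, hφ, rfl⟩) ⟨z, by simpa using hpos⟩
  have hxz : ip A x z = 0 := by rw [← star_ip, hz x hxs, star_zero]
  have hpyth : ip A (x - z) (x - z) = ip A x x + ip A z z := by
    rw [ip_sub_left, ip_sub_right, ip_sub_right, hxz, hz x hxs, sub_zero, zero_sub, sub_neg_eq_add]
  have hlt := (Real.sqrt_lt_sqrt_iff (hre _)).1 hx
  rw [hpyth, map_add, Complex.add_re] at hlt
  linarith [hre x]

lemma map_ip_self_eq_zero_of_dense_tau₂ {φ : A →ₚ[ℂ] ℂ} (hφ : IsNormalMap φ) {s : Set M}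
    (hs : @Dense M (tau₂ A M) s) {z : M} (hz : ∀ x ∈ s, ip A z x = 0) : φ (ip A z z) = 0 := by
  by_contra hne
  obtain ⟨x, hx, hxs⟩ := (@dense_iff_inter_open M (tau₂ A M) _).1 hs
    {x | ‖φ (ip A z (x - z))‖ < ‖φ (ip A z z)‖}
    (TopologicalSpace.isOpen_generateFrom_of_mem ⟨φ, z, z, _, hφ, rfl⟩) ⟨z, by simpa using hne⟩
  simp [ip_sub_right, hz x hxs] at hx

end WeakTopologies

section WStar

open InnerProductSpace

/-- A faithful representation whose image is a von Neumann algebra, that is, its own bicommutant. -/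
structure IsVonNeumannRep {A H : Type*} [NonUnitalCStarAlgebra A] [NormedAddCommGroup H]
    [InnerProductSpace ℂ H] [CompleteSpace H] (ρ : A →⋆ₙₐ[ℂ] (H →L[ℂ] H)) : Prop where
  injective : Function.Injective ρ
  exists_of_commute : ∀ T : H →L[ℂ] H,
    (∀ R : H →L[ℂ] H, (∀ a, Commute R (ρ a)) → Commute R T) → ∃ a, ρ a = T

lemma IsWStarAlgebra.exists_rep {A : Type u} [NonUnitalCStarAlgebra A] (hA : IsWStarAlgebra A) :
    ∃ (H : Type u) (_ : NormedAddCommGroup H) (_ : InnerProductSpace ℂ H) (_ : CompleteSpace H)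
      (ρ : A →⋆ₙₐ[ℂ] (H →L[ℂ] H)), IsVonNeumannRep ρ := by
  obtain ⟨H, _, _, _, N, ⟨e⟩⟩ := hA
  let ρ : A →⋆ₙₐ[ℂ] (H →L[ℂ] H) :=
    (N.toStarSubalgebra.subtype : N.toStarSubalgebra →⋆ₙₐ[ℂ] (H →L[ℂ] H)).comp
      (e : A →⋆ₙₐ[ℂ] N.toStarSubalgebra)
  refine ⟨H, _, _, _, ρ, ⟨Subtype.val_injective.comp e.injective, fun T hT => ?_⟩⟩
  have hTN : T ∈ N := by
    rw [← SetLike.mem_coe, ← N.centralizer_centralizer]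
    exact Set.mem_centralizer_iff.2 fun R hR => hT R fun a =>
      (Set.mem_centralizer_iff.1 hR _ (e a).2).symm
  exact ⟨e.symm ⟨T, hTN⟩, congrArg Subtype.val (e.apply_symm_apply ⟨T, hTN⟩)⟩

variable {A H : Type*} [NonUnitalCStarAlgebra A] [NormedAddCommGroup H]
  [InnerProductSpace ℂ H] [CompleteSpace H] {ρ : A →⋆ₙₐ[ℂ] (H →L[ℂ] H)}

lemma IsVonNeumannRep.norm_map (hρ : IsVonNeumannRep ρ) (a : A) : ‖ρ a‖ = ‖a‖ :=
  NonUnitalStarAlgHom.norm_map ρ hρ.injective a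

lemma IsVonNeumannRep.ext_inner (hρ : IsVonNeumannRep ρ) {a b : A}
    (h : ∀ ξ η, ⟪ξ, ρ a η⟫_ℂ = ⟪ξ, ρ b η⟫_ℂ) : a = b :=
  hρ.injective (ContinuousLinearMap.ext fun η => ext_inner_left ℂ fun ξ => h ξ η)

theorem IsVonNeumannRep.exists_tendsto_inner (hρ : IsVonNeumannRep ρ) {ι : Type*}
    {l : Ultrafilter ι} {a : ι → A} {C : ℝ} (hC : 0 ≤ C) (ha : ∀ᶠ i in l, ‖a i‖ ≤ C) :
    ∃ b : A, ‖b‖ ≤ C ∧ ∀ ξ η, Tendsto (fun i => ⟪ξ, ρ (a i) η⟫_ℂ) l (𝓝 ⟪ξ, ρ b η⟫_ℂ) := by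
  obtain ⟨T, hT_norm, hT⟩ := exists_tendsto_inner_of_eventually_norm_le (T := fun i => ρ (a i)) hC
    (ha.mono fun i hi => (hρ.norm_map _).trans_le hi)
  obtain ⟨b, rfl⟩ := hρ.exists_of_commute T fun R hR =>
    commute_of_tendsto_inner hT fun i => hR (a i)
  exact ⟨b, (hρ.norm_map b).symm.trans_le hT_norm, hT⟩

variable [PartialOrder A] [StarOrderedRing A]

lemma nonneg_of_map_nonneg {B : Type*} [NonUnitalCStarAlgebra B] [PartialOrder B]
    [StarOrderedRing B] {σ : A →⋆ₙₐ[ℂ] B} (hσ : Function.Injective σ) {a : A} (ha : 0 ≤ σ a) :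
    0 ≤ a := by
  have ha_sa : IsSelfAdjoint a := hσ ((map_star σ a).trans (IsSelfAdjoint.of_nonneg ha).star_eq)
  rw [← CFC.negPart_eq_zero_iff a]
  refine hσ ?_
  calc σ a⁻ = (σ a)⁻ := NonUnitalStarAlgHom.map_cfcₙ (S := ℂ) (R := ℝ) σ (·⁻) a
    _ = 0 := (CFC.negPart_eq_zero_iff (σ a)).2 ha
    _ = σ 0 := (map_zero σ).symm

lemma le_of_inner_map_le (hρ : Function.Injective ρ) {a b : A}
    (h : ∀ ξ, ⟪ξ, ρ a ξ⟫_ℂ ≤ ⟪ξ, ρ b ξ⟫_ℂ) : a ≤ b := by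
  refine sub_nonneg.1 (nonneg_of_map_nonneg hρ ?_)
  rw [ContinuousLinearMap.nonneg_iff_isPositive, ContinuousLinearMap.isPositive_iff_complex]
  intro ξ
  have hξ : 0 ≤ ⟪ρ (b - a) ξ, ξ⟫_ℂ := by
    have := sub_nonneg.2 (h ξ)
    rw [← inner_sub_right, ← sub_apply, ← map_sub] at this
    rwa [← inner_conj_symm, ← RCLike.star_def, star_nonneg_iff]
  exact ⟨(Complex.eq_re_of_ofReal_le hξ).symm, (Complex.le_def.1 hξ).1⟩

/-- The vector functional `a ↦ ⟪ξ, ρ a ξ⟫`, a prototype of a normal positive functional. -/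
def vectorFunctional (ρ : A →⋆ₙₐ[ℂ] (H →L[ℂ] H)) (ξ : H) : A →ₚ[ℂ] ℂ :=
  PositiveLinearMap.mk₀
    { toFun := fun a => ⟪ξ, ρ a ξ⟫_ℂ
      map_add' := fun a b => by rw [map_add, add_apply, inner_add_right]
      map_smul' := fun c a => by rw [map_smul, smul_apply, inner_smul_right]; rfl }
    fun _ ha => ((ContinuousLinearMap.nonneg_iff_isPositive _).1
      (map_nonneg ρ ha)).inner_nonneg_right ξ

lemma exists_vectorFunctional_ne_zero (hρ : Function.Injective ρ) {a : A} (ha : a ≠ 0) :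
    ∃ ξ, vectorFunctional ρ ξ a ≠ 0 := by
  by_contra! h
  have : (ρ a).toLinearMap = 0 :=
    (inner_map_self_eq_zero _).1 fun ξ => inner_eq_zero_symm.1 (h ξ)
  exact ha (hρ ((ContinuousLinearMap.coe_injective this).trans (map_zero ρ).symm))

lemma norm_le_of_mem_Icc {a b c : A} (h : b ∈ Set.Icc a c) : ‖b‖ ≤ ‖c - a‖ + ‖a‖ := by
  have : ‖b - a‖ ≤ ‖c - a‖ := CStarAlgebra.norm_le_norm_of_nonneg_of_le
    (sub_nonneg.2 h.1) (sub_le_sub_right h.2 a)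
  calc ‖b‖ ≤ ‖b - a‖ + ‖a‖ := norm_le_norm_sub_add b a
    _ ≤ ‖c - a‖ + ‖a‖ := by gcongr

theorem IsVonNeumannRep.exists_upperBound (hρ : IsVonNeumannRep ρ) {D : Set A} (hD : D.Nonempty)
    (hdir : DirectedOn (· ≤ ·) D) (hbdd : BddAbove D) :
    ∃ b ∈ upperBounds D, ∀ ξ, IsLUB (vectorFunctional ρ ξ '' D) (vectorFunctional ρ ξ b) := by
  obtain ⟨a₀, ha₀⟩ := hD
  obtain ⟨s, hs⟩ := hbdd
  have : Nonempty D := ⟨⟨a₀, ha₀⟩⟩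
  have : IsDirectedOrder D := ⟨directedOn_iff_directed.1 hdir⟩
  let l : Ultrafilter D := Ultrafilter.of atTop
  have htail (a : D) : ∀ᶠ i in (l : Filter D), a ≤ i := Ultrafilter.of_le _ (eventually_ge_atTop a)
  obtain ⟨b, -, hb⟩ := hρ.exists_tendsto_inner (l := l) (a := Subtype.val)
    (C := ‖s - a₀‖ + ‖a₀‖) (by positivity)
    ((htail ⟨a₀, ha₀⟩).mono fun i hi => norm_le_of_mem_Icc ⟨hi, hs i.2⟩)
  have hle : ∀ a ∈ D, ∀ ξ, vectorFunctional ρ ξ a ≤ vectorFunctional ρ ξ b := fun a ha ξ =>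
    ge_of_tendsto (hb ξ ξ)
      ((htail ⟨a, ha⟩).mono fun i hi => OrderHomClass.mono (vectorFunctional ρ ξ) hi)
  refine ⟨b, fun a ha => le_of_inner_map_le hρ.injective (hle a ha),
    fun ξ => ⟨Set.forall_mem_image.2 fun a ha => hle a ha ξ, fun z hz => ?_⟩⟩
  exact le_of_tendsto' (hb ξ ξ) fun i => hz (Set.mem_image_of_mem _ i.2)

theorem IsVonNeumannRep.isNormalMap_vectorFunctional (hρ : IsVonNeumannRep ρ) (ξ : H) :
    IsNormalMap (vectorFunctional ρ ξ) := by
  intro D hne hdir _ s hs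
  obtain ⟨b, hbD, hb⟩ := hρ.exists_upperBound hne hdir ⟨s, hs.1⟩
  have hmono : Monotone (vectorFunctional ρ ξ) := OrderHomClass.mono _
  exact ⟨hmono.mem_upperBounds_image hs.1, fun z hz => (hmono (hs.2 hbD)).trans ((hb ξ).2 hz)⟩

section HilbertModule

variable {M : Type*} [NormedAddCommGroup M] [NormedSpace ℂ M] [SMul Aᵐᵒᵖ M] [CStarModule Aᵐᵒᵖ M]

theorem IsSelfDual.exists_tendsto_inner_ip (hM : IsSelfDual A M) (hρ : IsVonNeumannRep ρ)
    {ι : Type*} {l : Ultrafilter ι} {m : ι → M} {C : ℝ} (hC : 0 ≤ C) (hm : ∀ i, ‖m i‖ ≤ C) :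
    ∃ z : M, ‖z‖ ≤ C ∧
      ∀ x ξ η, Tendsto (fun i => ⟪ξ, ρ (ip A (m i) x) η⟫_ℂ) l (𝓝 ⟪ξ, ρ (ip A z x) η⟫_ℂ) := by
  choose f hf_norm hf using fun x : M =>
    hρ.exists_tendsto_inner (l := l) (a := fun i => ip A (m i) x) (C := C * ‖x‖) (by positivity)
      (.of_forall fun i => (norm_ip_le A _ _).trans (by gcongr; exact hm i))
  have hf_eq {x b} (h : ∀ ξ η, Tendsto (fun i => ⟪ξ, ρ (ip A (m i) x) η⟫_ℂ) l
      (𝓝 ⟪ξ, ρ b η⟫_ℂ)) : f x = b :=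
    hρ.ext_inner fun ξ η => tendsto_nhds_unique (hf x ξ η) (h ξ η)
  let F : M →ₗ[ℂ] A :=
    { toFun := f
      map_add' := fun x y => hf_eq fun ξ η => by
        simpa only [ip_add_right, map_add, add_apply, inner_add_right]
          using (hf x ξ η).add (hf y ξ η)
      map_smul' := fun c x => hf_eq fun ξ η => by
        simpa only [ip_smul_right, map_smul, smul_apply, inner_smul_right, RingHom.id_apply]
          using (hf x ξ η).const_mul c }
  have hF_act : ∀ x y (a : A), y = op a • x → F y = F x * a := fun x y a hxy =>
    hf_eq fun ξ η => by
      simpa only [hxy, ip_act_right, map_mul, mul_apply_eq_comp] using! hf x ξ (ρ a η)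
  obtain ⟨z, hz_norm, hz⟩ := hM.hasRepresentation_id F C hC hF_act hf_norm
  have hfz x : f x = ip A z x := hz x
  exact ⟨z, hz_norm, fun x ξ η => hfz x ▸ hf x ξ η⟩

theorem IsWStarAlgebra.hasRepresentation [CompleteSpace M] (hA : IsWStarAlgebra A)
    (hM : IsSelfDual A M) {E : Type*} [AddCommGroup E] [Module ℂ E] {Φ : E →ₗ[ℂ] M}
    (hact : ∀ x (a : A), ∃ y, Φ y = op a • Φ x) : HasRepresentation A Φ := by
  classical
  intro f C hC hf hbound
  obtain ⟨H, _, _, _, ρ, hρ⟩ := hA.exists_rep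
  choose m hm_norm hm using fun i : Finset E × ℕ =>
    exists_norm_sub_ip_le hact hC hf hbound i.1 (s := 1 / ((i.2 : ℝ) + 1)) (by positivity)
  obtain ⟨z, hz_norm, hz⟩ :=
    hM.exists_tendsto_inner_ip hρ (l := Ultrafilter.of atTop) hC hm_norm
  refine ⟨z, hz_norm, fun x => hρ.ext_inner fun ξ η => tendsto_nhds_unique ?_ (hz (Φ x) ξ η)⟩
  have herror : Tendsto (fun i : Finset E × ℕ => C * √(1 / ((i.2 : ℝ) + 1))) atTop (𝓝 0) := by
    have : Tendsto (fun n : ℕ => C * √(1 / ((n : ℝ) + 1))) atTop (𝓝 (C * √0)) :=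
      (tendsto_one_div_add_atTop_nhds_zero_nat.sqrt).const_mul C
    rw [Real.sqrt_zero, mul_zero] at this
    exact this.comp (prod_atTop_atTop_eq (α := Finset E) (β := ℕ) ▸ tendsto_snd)
  have hlim : Tendsto (fun i => ip A (m i) (Φ x)) atTop (𝓝 (f x)) := by
    refine tendsto_iff_norm_sub_tendsto_zero.2
      (squeeze_zero' (.of_forall fun _ => norm_nonneg _) ?_ herror)
    filter_upwards [eventually_ge_atTop (({x} : Finset E), 0)] with i hi
    rw [norm_sub_rev]
    exact hm i x (hi.1 (Finset.mem_singleton_self x))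
  have hρ_cont : Continuous ρ := (AddMonoidHomClass.isometry_of_norm ρ hρ.norm_map).continuous
  have hinner : Continuous fun a : A => ⟪ξ, ρ a η⟫_ℂ :=
    continuous_const.inner (hρ_cont.clm_apply continuous_const)
  exact (hinner.tendsto _).comp (hlim.mono_left (Ultrafilter.of_le _))

theorem IsWStarAlgebra.isTotal_of_dense (hA : IsWStarAlgebra A) {s : Set M}
    (hs : @Dense M (tau₁ A M) s ∨ @Dense M (tau₂ A M) s) : IsTotal A s := by
  intro z hz
  obtain ⟨H, _, _, _, ρ, hρ⟩ := hA.exists_rep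
  by_contra hne
  obtain ⟨ξ, hξ⟩ := exists_vectorFunctional_ne_zero hρ.injective (a := ip A z z)
    fun h => hne (eq_zero_of_ip_self h)
  have hnormal := hρ.isNormalMap_vectorFunctional ξ
  exact hξ (hs.elim (map_ip_self_eq_zero_of_dense_tau₁ hnormal · hz)
    (map_ip_self_eq_zero_of_dense_tau₂ hnormal · hz))

end HilbertModule

end WStar

section Normal

section OrderedModule

variable {B C : Type*} [Star B] [Preorder B] [AddCommGroup C] [PartialOrder C]
  {f g : B → C}

lemma IsNormalMap.of_add [IsOrderedAddMonoid C] (hf : Monotone f) (hg : Monotone g)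
    (h : IsNormalMap fun b => f b + g b) : IsNormalMap f := fun D hne hdir hD s hs => by
  refine ⟨hf.mem_upperBounds_image hs.1, fun z hz => ?_⟩
  have : f s + g s ≤ z + g s := (h D hne hdir hD s hs).2 <| Set.forall_mem_image.2 fun b hb =>
    add_le_add (hz (Set.mem_image_of_mem f hb)) (hg (hs.1 hb))
  exact le_of_add_le_add_right this

lemma IsNormalMap.of_smul [Module ℝ C] [PosSMulMono ℝ C] {t : ℝ} (ht : 0 < t)
    (h : IsNormalMap fun b => t • f b) : IsNormalMap f := fun D hne hdir hD s hs => by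
  have := h D hne hdir hD s hs
  rw [← Set.image_image (t • ·) f] at this
  exact (OrderIso.smulRight ht).isLUB_image'.1 this

end OrderedModule

variable {A B V G : Type*} [NonUnitalCStarAlgebra A] [PartialOrder A]
  [CStarAlgebra B] [PartialOrder B] [StarOrderedRing B] [AddCommGroup V] [Module ℂ V]
  [SMul Aᵐᵒᵖ V] [Group G]

lemma IsCP.diag_nonneg {R : B →ₗ[ℂ] SesqForm A V} (hR : IsCP R) {b : B} (hb : 0 ≤ b) (v : V) :
    0 ≤ (R b).1 v v := by
  obtain ⟨c, rfl⟩ := CStarAlgebra.nonneg_iff_eq_star_mul_self.1 hb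
  simpa only [Finset.univ_unique, Finset.sum_singleton] using hR 1 (fun _ => c) fun _ => v

lemma IsCP.monotone_diag [IsOrderedAddMonoid A] {R : B →ₗ[ℂ] SesqForm A V} (hR : IsCP R) (v : V) :
    Monotone fun b => (R b).1 v v := fun b c hbc => by
  have := hR.diag_nonneg (sub_nonneg.2 hbc) v
  rwa [map_sub, Submodule.coe_sub, LinearMap.sub_apply, LinearMap.sub_apply, sub_nonneg] at this

theorem isExtreme_NCP [StarOrderedRing A] (β : G →* (B ≃⋆ₐ[ℂ] B)) (U : G →* (V ≃ₗ[ℂ] V))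
    (s₁ : SesqForm A V) : IsExtreme ℝ (CP β U s₁) (NCP β U s₁) where
  subset _ hS := hS.1
  left_mem_of_mem_openSegment := by
    rintro R hR R' hR' _ hS ⟨t, t', ht, ht', -, rfl⟩
    exact ⟨hR, fun v => .of_smul ht <|
      .of_add (g := fun b => t' • (R' b).1 v v) ((hR.1.monotone_diag v).const_smul ht.le)
        ((hR'.1.monotone_diag v).const_smul ht'.le) (hS.2 v)⟩

end Normal

end CovCP

end

theorem mainTheorem3_general {A : Type*} {B : Type*} {V : Type*} {G : Type*}
    [NonUnitalCStarAlgebra A] [PartialOrder A] [StarOrderedRing A]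
    [CStarAlgebra B] [PartialOrder B] [StarOrderedRing B]
    [AddCommGroup V] [Module ℂ V] [SMul Aᵐᵒᵖ V] [Group G]
    (β : G →* (B ≃⋆ₐ[ℂ] B)) (U : G →* (V ≃ₗ[ℂ] V)) (s₁ : CovCP.SesqForm A V)
    (S : B →ₗ[ℂ] CovCP.SesqForm A V) (hS : S ∈ CovCP.CP β U s₁) :
    (∀ (M : Type*) [NormedAddCommGroup M] [NormedSpace ℂ M] [CompleteSpace M]
      [SMul Aᵐᵒᵖ M] [CStarModule Aᵐᵒᵖ M] (d : CovCP.CovariantDilation β U S M),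
      d.IsMinimal →
        (S ∈ (CovCP.CP β U s₁).extremePoints ℝ → d.ExtremalityCondition) ∧
        (CovCP.IsSelfDual A M → d.ExtremalityCondition →
          S ∈ (CovCP.CP β U s₁).extremePoints ℝ)) ∧
    (CovCP.IsWStarAlgebra A →
      ∀ (L : Type*) [NormedAddCommGroup L] [NormedSpace ℂ L] [CompleteSpace L]
        [SMul Aᵐᵒᵖ L] [CStarModule Aᵐᵒᵖ L] (d : CovCP.CovariantDilation β U S L),
        d.IsWStarMinimal →
          (S ∈ (CovCP.CP β U s₁).extremePoints ℝ ↔ d.ExtremalityCondition)) ∧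
    (S ∈ CovCP.NCP β U s₁ →
      (S ∈ (CovCP.NCP β U s₁).extremePoints ℝ ↔ S ∈ (CovCP.CP β U s₁).extremePoints ℝ)) := by
  refine ⟨fun M _ _ _ _ _ d hd => ?_, fun hA L _ _ _ _ _ d hd => ?_, fun hS_normal => ?_⟩
  · have htotal := CovCP.isTotal_of_dense (A := A) hd
    exact ⟨fun h => d.extremalityCondition_of_mem_extremePoints h htotal, fun hM h =>
      d.mem_extremePoints_of_extremalityCondition hS hM htotal
        (hM.hasRepresentation_of_denseRange d.exists_gen_eq_act (d.denseRange_gen hd)) h⟩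
  · have htotal := hA.isTotal_of_dense hd.2
    exact ⟨fun h => d.extremalityCondition_of_mem_extremePoints h htotal, fun h =>
      d.mem_extremePoints_of_extremalityCondition hS hd.1 htotal
        (hA.hasRepresentation hd.1 d.exists_gen_eq_act) h⟩
  · rw [(CovCP.isExtreme_NCP β U s₁).extremePoints_eq]
    exact Set.mem_inter_iff _ _ _ |>.trans (and_iff_right hS_normal)

theorem mainTheorem3 {A : Type*} {B : Type*} {V : Type*} {G : Type*}
    [NonUnitalCStarAlgebra A] [PartialOrder A] [StarOrderedRing A]
    [CStarAlgebra B] [PartialOrder B] [StarOrderedRing B]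
    [AddCommGroup V] [Module ℂ V] [SMul Aᵐᵒᵖ V] [CovCP.IsRightModule A V] [Group G]
    (β : G →* (B ≃⋆ₐ[ℂ] B))
    (U : G →* (V ≃ₗ[ℂ] V)) (hU : ∀ g, CovCP.IsModuleMap A (U g))
    (s₁ : CovCP.SesqForm A V) (hs₁ : CovCP.SesqForm.IsPositive s₁)
    (S : B →ₗ[ℂ] CovCP.SesqForm A V) (hS : S ∈ CovCP.CP β U s₁) :
    -- minimal dilations over a C⋆-algebra
    (∀ (M : Type*) [NormedAddCommGroup M] [NormedSpace ℂ M] [CompleteSpace M]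
      [SMul Aᵐᵒᵖ M] [CStarModule Aᵐᵒᵖ M] (d : CovCP.CovariantDilation β U S M),
      d.IsMinimal →
        (S ∈ (CovCP.CP β U s₁).extremePoints ℝ → d.ExtremalityCondition) ∧
        (CovCP.IsSelfDual A M → d.ExtremalityCondition →
          S ∈ (CovCP.CP β U s₁).extremePoints ℝ)) ∧
    -- W⋆-minimal dilations over a W⋆-algebra
    (CovCP.IsWStarAlgebra A →
      ∀ (L : Type*) [NormedAddCommGroup L] [NormedSpace ℂ L] [CompleteSpace L]
        [SMul Aᵐᵒᵖ L] [CStarModule Aᵐᵒᵖ L] (d : CovCP.CovariantDilation β U S L),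
        d.IsWStarMinimal →
          (S ∈ (CovCP.CP β U s₁).extremePoints ℝ ↔ d.ExtremalityCondition)) ∧
    -- normal maps
    (CovCP.IsWStarAlgebra A → CovCP.IsWStarAlgebra B → S ∈ CovCP.NCP β U s₁ →
      (S ∈ (CovCP.NCP β U s₁).extremePoints ℝ ↔ S ∈ (CovCP.CP β U s₁).extremePoints ℝ)) := by
  obtain ⟨hminimal, hWStarMinimal, hnormal⟩ := mainTheorem3_general β U s₁ S hS
  exact ⟨hminimal, hWStarMinimal, fun _ _ => hnormal⟩
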